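/- Let $k$ be a field of characteristic zero and let $A$ be a finite-dimensional associative $k$-algebra with a unit element. Let $\mathfrak g$ be $A$ viewed as a Lie algebra with bracket $[a,b]=ab-ba$, let $V=A$ be viewed as a $\mathfrak g$-module by left multiplication, and let $L=\mathfrak g\oplus V$ be the semi-direct product, i.e. $[(a,v),(b,w)]=(ab-ba,\;aw-bv)$. For $f\in L^*$ put $L(f)=\{x\in L : f([x,y])=0 \text{ for all } y\in L\}$, let $i(L)=\min_{f\in L^*}\dim L(f)$ be the index of $L$, and call $f$ regular if $\dim L(f)=i(L)$. The enveloping algebra $U(L)$ is an Ore domain; let $D(L)$ be its quotient division ring, and let $R(V)\subseteq D(L)$ be the subfield generated by $k$ and $V$, i.e. the quotient field of the symmetric algebra $S(V)=U(V)\subseteq U(L)$. Then the following conditions are equivalent: 1. $A$ is a Frobenius algebra, i.e. the left regular module $A$ is isomorphic, as a left $A$-module, to the dual $\operatorname{Hom}_k(A,k)$ of the right regular module, where $(a\varphi)(x)=\varphi(xa)$. 2. $L$ is a Frobenius Lie algebra, i.e. $i(L)=0$. 3. $V$ is a CP-ideal (commutative polarization ideal) of $L$, i.e. $V$ is a commutative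 ideal of $L$ which is a polarization with respect to every regular $f\in L^*$: $f([V,V])=0$ and $\dim V=\tfrac12(\dim L+\dim L(f))$. 4. $R(V)$ is a maximal (commutative) subfield of the division ring $D(L)$. -/

import Mathlib

open scoped nonZeroDivisors

noncomputable section

/-! ### Frobenius algebras -/

/-- A finite-dimensional unital associative algebra `A` is a Frobenius algebra if the left regular
module `A` is isomorphic, as a left `A`-module, to the dual of the right regular module. The left
action of `A` on `A → k` is `(a • φ) x = φ (x * a)`. -/
def IsFrobeniusAlgebra (k A : Type*) [Field k] [Ring A] [Algebra k A] : Prop :=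
  ∃ e : A ≃ₗ[k] Module.Dual k A, ∀ a b x : A, e (a * b) x = e b (x * a)

/-! ### Index, polarizations and commutative polarizations -/

section Polarization

variable (k : Type*) {L : Type*} [Field k] [LieRing L] [LieAlgebra k L]

/-- `L(f) = {x ∈ L | f([x, y]) = 0 for all y ∈ L}`. -/
def lieStabilizer (f : Module.Dual k L) : Submodule k L where
  carrier := {x | ∀ y : L, f ⁅x, y⁆ = 0}
  zero_mem' := fun y => by simp
  add_mem' := fun {a b} ha hb y => by
    rw [add_lie, map_add, ha y, hb y, add_zero]
  smul_mem' := fun c x hx y => by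
    rw [smul_lie, map_smul, hx y, smul_zero]

variable (L) in
/-- The index `i(L)`, the minimum of `dim L(f)` over all `f ∈ L*`. -/
def lieIndex : ℕ := ⨅ f : Module.Dual k L, Module.finrank k (lieStabilizer k f)

/-- `f ∈ L*` is regular if `dim L(f) = i(L)`. -/
def IsRegularForm (f : Module.Dual k L) : Prop :=
  Module.finrank k (lieStabilizer k f) = lieIndex k L

variable (L) in
/-- A Frobenius Lie algebra is a Lie algebra of index zero. -/
def IsFrobeniusLieAlgebra : Prop := lieIndex k L = 0

variable {k}

/-- The Lie subalgebra `P` is a polarization with respect to `f`: `f([P, P]) = 0` and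
`dim P = (dim L + dim L(f)) / 2`. -/
def IsPolarization (P : LieSubalgebra k L) (f : Module.Dual k L) : Prop :=
  (∀ x ∈ P, ∀ y ∈ P, f ⁅x, y⁆ = 0) ∧
    2 * Module.finrank k P = Module.finrank k L + Module.finrank k (lieStabilizer k f)

/-- The Lie subalgebra `P` is a CP (commutative polarization) of `L`: it is commutative and a
polarization with respect to every regular `f ∈ L*`. -/
def IsCP (P : LieSubalgebra k L) : Prop :=
  (∀ x ∈ P, ∀ y ∈ P, ⁅x, y⁆ = 0) ∧
    ∀ f : Module.Dual k L, IsRegularForm k f → IsPolarization P f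

/-- A CP-ideal is a CP which is an ideal of `L`. -/
def IsCPIdeal (P : LieSubalgebra k L) : Prop :=
  IsCP P ∧ ∀ x : L, ∀ y ∈ P, ⁅x, y⁆ ∈ P

end Polarization

/-! ### The quotient division ring of the enveloping algebra -/

section QuotientDivisionRing

variable (k L : Type*) [Field k] [LieRing L] [LieAlgebra k L]

/-- `D(L)`, the quotient division ring of the enveloping algebra `U(L)`: the Ore localization of
`U(L)` at its nonzero elements, for `U(L)` an Ore domain. -/
abbrev QuotientDivisionRing [IsDomain (UniversalEnvelopingAlgebra k L)]
    [OreLocalization.OreSet (UniversalEnvelopingAlgebra k L)⁰] : Type _ :=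
  OreLocalization (UniversalEnvelopingAlgebra k L)⁰ (UniversalEnvelopingAlgebra k L)

variable {k L}
variable [IsDomain (UniversalEnvelopingAlgebra k L)]
  [OreLocalization.OreSet (UniversalEnvelopingAlgebra k L)⁰]

/-- `D(P)` as a sub-division ring of `D(L)`: the one generated by `k` and `P`. For commutative `P`
we have `U(P) = S(P)`, and this is the field of fractions `R(P)` of `S(P)` inside `D(L)`. -/
def subQuotientDivisionRing (P : LieSubalgebra k L) : Subfield (QuotientDivisionRing k L) :=
  Subfield.closure
    ((fun u : UniversalEnvelopingAlgebra k L =>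
        (OreLocalization.numeratorRingHom u : QuotientDivisionRing k L)) ''
      (Set.range (algebraMap k (UniversalEnvelopingAlgebra k L)) ∪
        UniversalEnvelopingAlgebra.ι k '' (P : Set L)))

end QuotientDivisionRing

/-- A maximal (commutative) subfield of a division ring `D`. Mathlib's `Subfield D` is the type of
sub-division rings of `D`, so commutativity has to be asked for. -/
def IsMaximalSubfield {D : Type*} [DivisionRing D] (K : Subfield D) : Prop :=
  Maximal (fun F : Subfield D => ∀ x ∈ F, ∀ y ∈ F, x * y = y * x) K

/-! ### The semi-direct product `L = 𝔤 ⊕ V` -/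

/-- The semi-direct product `L = 𝔤 ⊕ V`, where `𝔤 = A` with the commutator bracket and `V = A` with
`𝔤` acting by left multiplication. -/
@[ext]
structure RegularSemidirect (A : Type*) where
  /-- The component in `𝔤 = A`. -/
  g : A
  /-- The component in `V = A`. -/
  v : A

namespace RegularSemidirect

/-- As a set, the semi-direct product is `A × A`; the vector space structure is transported along
this bijection. -/
def equivProd (A : Type*) : RegularSemidirect A ≃ A × A where
  toFun x := (x.g, x.v)
  invFun p := ⟨p.1, p.2⟩
  left_inv _ := rfl
  right_inv _ := rfl

section Ring

variable {A : Type*} [Ring A]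

instance : AddCommGroup (RegularSemidirect A) := (equivProd A).addCommGroup

/-- `[(a, v), (b, w)] = (ab - ba, aw - bv)`. -/
instance : Bracket (RegularSemidirect A) (RegularSemidirect A) :=
  ⟨fun x y => ⟨x.g * y.g - y.g * x.g, x.g * y.v - y.g * x.v⟩⟩

@[simp] theorem g_add (x y : RegularSemidirect A) : (x + y).g = x.g + y.g := rfl

@[simp] theorem v_add (x y : RegularSemidirect A) : (x + y).v = x.v + y.v := rfl

@[simp] theorem g_zero : (0 : RegularSemidirect A).g = 0 := rfl

@[simp] theorem v_zero : (0 : RegularSemidirect A).v = 0 := rfl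

@[simp] theorem g_lie (x y : RegularSemidirect A) : ⁅x, y⁆.g = x.g * y.g - y.g * x.g := rfl

@[simp] theorem v_lie (x y : RegularSemidirect A) : ⁅x, y⁆.v = x.g * y.v - y.g * x.v := rfl

instance : LieRing (RegularSemidirect A) where
  add_lie x y z := by
    ext <;> simp only [g_lie, v_lie, g_add, v_add] <;> noncomm_ring
  lie_add x y z := by
    ext <;> simp only [g_lie, v_lie, g_add, v_add] <;> noncomm_ring
  lie_self x := by
    ext <;> simp only [g_lie, v_lie, g_zero, v_zero, sub_self]
  leibniz_lie x y z := by
    ext <;> simp only [g_lie, v_lie, g_add, v_add] <;> noncomm_ring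

end Ring

section Algebra

variable (k A : Type*) [Field k] [Ring A] [Algebra k A]

instance : Module k (RegularSemidirect A) := (equivProd A).module k

variable {k A} in
@[simp] theorem g_smul (c : k) (x : RegularSemidirect A) : (c • x).g = c • x.g := rfl

variable {k A} in
@[simp] theorem v_smul (c : k) (x : RegularSemidirect A) : (c • x).v = c • x.v := rfl

instance : LieAlgebra k (RegularSemidirect A) where
  lie_smul c x y := by
    ext <;> simp only [g_lie, v_lie, g_smul, v_smul, smul_sub, mul_smul_comm, smul_mul_assoc]

/-- The summand `V` of `L = 𝔤 ⊕ V`, as a Lie subalgebra of `L`. -/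
def V : LieSubalgebra k (RegularSemidirect A) where
  carrier := {x | x.g = 0}
  zero_mem' := g_zero
  add_mem' := fun {x y} (hx : x.g = 0) (hy : y.g = 0) => show (x + y).g = 0 by
    rw [g_add, hx, hy, add_zero]
  smul_mem' := fun c x (hx : x.g = 0) => show (c • x).g = 0 by
    rw [g_smul, hx, smul_zero]
  lie_mem' := fun {x y} (hx : x.g = 0) (hy : y.g = 0) => show ⁅x, y⁆.g = 0 by
    rw [g_lie, hx, hy, mul_zero, sub_zero]

end Algebra

end RegularSemidirect

end

/-! Each of the four conditions amounts to the existence of a linear form `f` on `A` with `f(xy)`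
nondegenerate (`HasNondegenerateForm`). For a Frobenius algebra, `f` is the image of `1`. For the
index, the stabilizer of a form on `L` meets `V` in the radical of its restriction to `V`, and the
extension by zero of a nondegenerate `f` has stabilizer zero. Since `dim L = 2 dim V` and `V` is a
commutative ideal, being a CP-ideal says only that regular forms have stabilizer zero.

The maximality of `R(V)` is the deep condition. Let `M` be the matrix of the products `c i * c j`,
with entries in `S(V)`. Its value at `f` is the Gram matrix of `f(xy)`, and `k` is infinite, so `det
M ≠ 0` exactly when a nondegenerate form exists (`det_structureMatrix_ne_zero_iff`). Filter `U(L)`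
by giving `𝔤` weight one and `V` weight zero. As `filt` uses strict bounds, `filt _ _ 1` is `U(V)`
and `filt _ _ 0` is zero. Symbols are polynomials, and on them the commutator with a basis vector `c
j` of `V` is the derivation `∑ i, M i j * ∂ i`, where `∂ i` differentiates in the `𝔤`-variables
(`bracketDerivation_inV`). If `det M ≠ 0`, the symbol of an element commuting with `V` has all `∂ i`
zero, hence weight zero in characteristic zero, so `V` has centralizer `U(V)`
(`mem_filt_of_commute`); choosing a minimal denominator carries this over to `D(L)`. If `det M = 0`,
a left null vector `s` of `M` gives an element `∑ s i * g i`, with `g i` the copy of `c i` in `𝔤`,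
that commutes with `V` and lies outside `R(V)` (`exists_commute_of_det_eq_zero`).

Symbols need the Poincaré–Birkhoff–Witt theorem (`quantization_injective`). It is obtained in
characteristic zero for a Lie algebra embedded in `U(L)`: contracting the comultiplication with a
suitable linear form acts on symbols as a partial derivative, which allows induction on the degree.
Here the embedding comes from 2 × 2 matrices over `A`. Products of symbols then show that `U(L)` is
a domain, and polynomial growth gives the Ore condition. -/

noncomputable section

namespace UniversalEnvelopingAlgebra

open MvPolynomial

/-! ### Weighted filtrations of the enveloping algebra -/

variable {k L κ : Type*} [Field k] [LieRing L] [LieAlgebra k L]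

variable (k) in
/-- The canonical map from `L` to `U(L)`, as a linear map. -/
def incl : L →ₗ[k] UniversalEnvelopingAlgebra k L where
  toFun := ι k
  map_add' := map_add (ι k)
  map_smul' := map_smul (ι k)

theorem incl_apply (x : L) : incl k x = ι k x := rfl

theorem incl_bracket (x y : L) : incl k ⁅x, y⁆ = incl k x * incl k y - incl k y * incl k x := by
  let _ : LieRing (UniversalEnvelopingAlgebra k L) := LieRing.ofAssociativeRing
  rw [incl_apply, LieHom.map_lie, LieRing.of_associative_ring_bracket]
  rfl

/-- By the universal property, `L → S` extends to `U(L) → S`, and following it by the inclusion of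
`S` gives the identity. -/
theorem mem_of_incl_mem (S : Subalgebra k (UniversalEnvelopingAlgebra k L))
    (hS : ∀ x : L, incl k x ∈ S) (u : UniversalEnvelopingAlgebra k L) : u ∈ S := by
  let _ : LieRing (UniversalEnvelopingAlgebra k L) := LieRing.ofAssociativeRing
  let _ : LieRing S := LieRing.ofAssociativeRing
  let f : L →ₗ⁅k⁆ S :=
    { toFun x := ⟨incl k x, hS x⟩
      map_add' x y := Subtype.ext (map_add _ x y)
      map_smul' c x := Subtype.ext (map_smul _ c x)
      map_lie' {x y} := Subtype.ext (incl_bracket x y) }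
  have h : S.val.comp (lift k f) = AlgHom.id k _ := by
    refine UniversalEnvelopingAlgebra.hom_ext _ (LieHom.ext fun x => ?_)
    change ((lift k f (ι k x) : S) : UniversalEnvelopingAlgebra k L) = ι k x
    rw [lift_ι_apply]
    rfl
  rw [← AlgHom.id_apply (R := k) u, ← h]
  exact (lift k f u).2

/-- The product in `U(L)` of a list of basis elements of `L`. -/
def listProd (b : Module.Basis κ k L) (l : List κ) : UniversalEnvelopingAlgebra k L :=
  (l.map fun i => incl k (b i)).prod

@[simp] theorem listProd_nil (b : Module.Basis κ k L) : listProd b [] = 1 := rfl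

@[simp] theorem listProd_cons (b : Module.Basis κ k L) (i : κ) (l : List κ) :
    listProd b (i :: l) = incl k (b i) * listProd b l := by
  simp [listProd]

theorem listProd_append (b : Module.Basis κ k L) (l l' : List κ) :
    listProd b (l ++ l') = listProd b l * listProd b l' := by
  simp [listProd]

/-- The total weight of a list of indices. -/
def listWeight (w : κ → ℤ) (l : List κ) : ℤ := (l.map w).sum

@[simp] theorem listWeight_nil (w : κ → ℤ) : listWeight w [] = 0 := rfl

@[simp] theorem listWeight_cons (w : κ → ℤ) (i : κ) (l : List κ) :
    listWeight w (i :: l) = w i + listWeight w l := by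
  simp [listWeight]

theorem listWeight_append (w : κ → ℤ) (l l' : List κ) :
    listWeight w (l ++ l') = listWeight w l + listWeight w l' := by
  simp [listWeight]

theorem listWeight_perm (w : κ → ℤ) {l l' : List κ} (h : l.Perm l') :
    listWeight w l = listWeight w l' :=
  (h.map w).sum_eq

theorem listWeight_one (l : List κ) : listWeight 1 l = l.length := by
  induction l with
  | nil => simp
  | cons i l ih => simp [ih, add_comm]

/-- The span of the products of basis elements of total weight less than `m`. -/
def filt (b : Module.Basis κ k L) (w : κ → ℤ) (m : ℤ) :
    Submodule k (UniversalEnvelopingAlgebra k L) :=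
  Submodule.span k (listProd b '' {l | listWeight w l < m})

/-- Nonnegative weights of the basis elements for which the associated graded algebra of the
filtration is commutative. -/
structure IsAdapted (b : Module.Basis κ k L) (w : κ → ℤ) : Prop where
  nonneg : ∀ i, 0 ≤ w i
  lie_mem : ∀ i j, ⁅b i, b j⁆ ∈ Submodule.span k (b '' {l | w l + 1 ≤ w i + w j})

theorem isAdapted_one (b : Module.Basis κ k L) : IsAdapted b 1 where
  nonneg _ := zero_le_one
  lie_mem i j := by
    have h : {l : κ | (1 : κ → ℤ) l + 1 ≤ (1 : κ → ℤ) i + (1 : κ → ℤ) j} = Set.univ := by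
      ext; simp
    rw [h, Set.image_univ, b.span_eq]
    trivial

variable {b : Module.Basis κ k L} {w : κ → ℤ}

theorem listWeight_nonneg (hw : ∀ i, 0 ≤ w i) (l : List κ) : 0 ≤ listWeight w l := by
  induction l with
  | nil => simp
  | cons i l ih => rw [listWeight_cons]; exact add_nonneg (hw i) ih

theorem listProd_mem_filt {l : List κ} {m : ℤ} (h : listWeight w l < m) :
    listProd b l ∈ filt b w m :=
  Submodule.subset_span ⟨l, h, rfl⟩

theorem filt_mono {m n : ℤ} (h : m ≤ n) : filt b w m ≤ filt b w n :=
  Submodule.span_mono (Set.image_mono fun _ hl => lt_of_lt_of_le hl h)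

theorem filt_eq_bot (hw : ∀ i, 0 ≤ w i) {m : ℤ} (h : m ≤ 0) : filt b w m = ⊥ := by
  rw [filt, Submodule.span_eq_bot]
  rintro _ ⟨l, hl, rfl⟩
  exact absurd (lt_of_lt_of_le hl h) (not_lt.2 (listWeight_nonneg hw l))

/-- Both bounds are strict and integral, so the weights add up to at most `m + n - 2`; this is the
source of the gain of one. -/
theorem mul_mem_filt {u v : UniversalEnvelopingAlgebra k L} {m n t : ℤ} (hu : u ∈ filt b w m)
    (hv : v ∈ filt b w n) (ht : m + n ≤ t + 1) : u * v ∈ filt b w t := by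
  have h := Submodule.mul_mem_mul hu hv
  rw [filt, filt, Submodule.span_mul_span] at h
  refine Submodule.span_le.2 ?_ h
  rintro _ ⟨_, ⟨l, hl, rfl⟩, _, ⟨l', hl', rfl⟩, rfl⟩
  simp only [← listProd_append]
  refine listProd_mem_filt ?_
  rw [listWeight_append]
  simp only [Set.mem_ofPred_eq] at hl hl'
  lia

theorem incl_mem_filt_of_mem_span {x : L} {m : ℤ}
    (hx : x ∈ Submodule.span k (b '' {l | w l + 1 ≤ m})) : incl k x ∈ filt b w m := by
  induction hx using Submodule.span_induction with
  | mem x hx =>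
    obtain ⟨i, hi, rfl⟩ := hx
    have : listProd b [i] ∈ filt b w m := listProd_mem_filt (by
      simp only [Set.mem_ofPred_eq] at hi; simp; lia)
    simpa using this
  | zero => simp
  | add x y _ _ hx hy => rw [map_add]; exact add_mem hx hy
  | smul c x _ hx => rw [map_smul]; exact Submodule.smul_mem _ c hx

theorem incl_basis_mem_filt (i : κ) : incl k (b i) ∈ filt b w (w i + 1) :=
  incl_mem_filt_of_mem_span (Submodule.subset_span ⟨i, le_refl (w i + 1), rfl⟩)

/-- Swapping two neighbours costs their bracket, which has lower weight because the weights are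
adapted. -/
theorem listProd_perm (h : IsAdapted b w) {l l' : List κ} (hl : l.Perm l') :
    listProd b l - listProd b l' ∈ filt b w (listWeight w l) := by
  induction hl with
  | nil => simp
  | cons i hl ih =>
    rw [listProd_cons, listProd_cons, ← mul_sub, listWeight_cons]
    exact mul_mem_filt (incl_basis_mem_filt i) ih (by lia)
  | swap i j l =>
    have : listProd b (j :: i :: l) - listProd b (i :: j :: l) = incl k ⁅b j, b i⁆ * listProd b l := by
      rw [incl_bracket]; simp only [listProd_cons]; noncomm_ring
    rw [this]
    exact mul_mem_filt (incl_mem_filt_of_mem_span (h.lie_mem j i))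
      (listProd_mem_filt (lt_add_one _)) (by simp; lia)
  | trans h₁ h₂ ih₁ ih₂ =>
    rw [← sub_add_sub_cancel]
    exact add_mem ih₁ (by rwa [listWeight_perm w h₁])

/-- `U(L)` is the union of the filtration. -/
theorem exists_mem_filt (b : Module.Basis κ k L) (w : κ → ℤ) (u : UniversalEnvelopingAlgebra k L) :
    ∃ n : ℕ, u ∈ filt b w n := by
  let S : Subalgebra k (UniversalEnvelopingAlgebra k L) :=
    { carrier := {u | ∃ n : ℕ, u ∈ filt b w n}
      mul_mem' := by
        rintro u v ⟨m, hu⟩ ⟨n, hv⟩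
        exact ⟨m + n, mul_mem_filt hu hv (by push_cast; lia)⟩
      add_mem' := by
        rintro u v ⟨m, hu⟩ ⟨n, hv⟩
        exact ⟨m + n, add_mem (filt_mono (by push_cast; lia) hu) (filt_mono (by push_cast; lia) hv)⟩
      algebraMap_mem' := fun c => ⟨1, by
        rw [Algebra.algebraMap_eq_smul_one]
        exact Submodule.smul_mem _ c (listProd_mem_filt (l := []) (by simp))⟩ }
  refine mem_of_incl_mem S (fun x => ?_) u
  induction b.mem_span x using Submodule.span_induction with
  | mem x hx =>
    obtain ⟨i, rfl⟩ := hx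
    exact ⟨(w i + 1).toNat, filt_mono (Int.self_le_toNat _) (incl_basis_mem_filt i)⟩
  | zero => rw [map_zero]; exact S.zero_mem
  | add x y _ _ hx hy => rw [map_add]; exact S.add_mem hx hy
  | smul c x _ hx => rw [map_smul]; exact S.smul_mem hx c

/-! ### The symmetrised monomials -/

/-- The monomial of a list of indices. -/
def listMonomial (k : Type*) [Field k] (l : List κ) : MvPolynomial κ k := (l.map X).prod

@[simp] theorem listMonomial_nil : listMonomial k ([] : List κ) = 1 := rfl

@[simp] theorem listMonomial_cons (i : κ) (l : List κ) :
    listMonomial k (i :: l) = X i * listMonomial k l := by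
  simp [listMonomial]

theorem listMonomial_append (l l' : List κ) :
    listMonomial k (l ++ l') = listMonomial k l * listMonomial k l' := by
  simp [listMonomial]

theorem listMonomial_eq [DecidableEq κ] (l : List κ) :
    listMonomial k l = monomial (Multiset.toFinsupp (l : Multiset κ)) 1 := by
  induction l with
  | nil => simp
  | cons i l ih =>
    rw [listMonomial_cons, ih, ← Multiset.cons_coe, ← Multiset.singleton_add, map_add,
      Multiset.toFinsupp_singleton, X, monomial_mul, one_mul]

/-- A list of indices with prescribed multiplicities. -/
def exponentList (s : κ →₀ ℕ) : List κ := (Finsupp.toMultiset s).toList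

theorem listMonomial_exponentList (s : κ →₀ ℕ) :
    listMonomial k (exponentList s) = monomial s 1 := by
  classical
  rw [listMonomial_eq, exponentList, Multiset.coe_toList, Finsupp.toMultiset_toFinsupp]

theorem exponentList_perm [DecidableEq κ] (l : List κ) :
    (exponentList (Multiset.toFinsupp (l : Multiset κ))).Perm l := by
  rw [← Multiset.coe_eq_coe, exponentList, Multiset.coe_toList, Multiset.toFinsupp_toMultiset]

theorem listMonomial_isWeightedHomogeneous (w : κ → ℤ) (l : List κ) :
    IsWeightedHomogeneous w (listMonomial k l) (listWeight w l) := by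
  induction l with
  | nil => exact isWeightedHomogeneous_one k w
  | cons i l ih =>
    rw [listMonomial_cons, listWeight_cons]
    exact (isWeightedHomogeneous_X k w i).mul ih

theorem listWeight_exponentList (w : κ → ℤ) (s : κ →₀ ℕ) :
    listWeight w (exponentList s) = Finsupp.weight w s := by
  -- No coefficient field occurs in the claim; over `ℚ` the monomial is nonzero, so its weight is
  -- unique.
  have h := listMonomial_isWeightedHomogeneous (k := ℚ) w (exponentList s)
  rw [listMonomial_exponentList] at h
  exact ((isWeightedHomogeneous_monomial w s (1 : ℚ) rfl).inj_right (by simp) h).symm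

variable (b) in
/-- The linear map from polynomials to `U(L)` that sends a monomial to a product of basis elements
in some order. -/
def quantization : MvPolynomial κ k →ₗ[k] UniversalEnvelopingAlgebra k L :=
  (basisMonomials κ k).constr k fun s => listProd b (exponentList s)

theorem quantization_monomial (s : κ →₀ ℕ) :
    quantization b (monomial s 1) = listProd b (exponentList s) := by
  have := (basisMonomials κ k).constr_basis k (fun s => listProd b (exponentList s)) s
  rwa [coe_basisMonomials] at this

@[simp] theorem quantization_one : quantization b 1 = 1 := by
  have := quantization_monomial (b := b) 0
  simpa [exponentList] using this

@[simp] theorem quantization_X (i : κ) : quantization b (X i) = incl k (b i) := by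
  have := quantization_monomial (b := b) (Finsupp.single i 1)
  simpa [exponentList, X] using this

/-- The linear embedding of `L` in its symmetric algebra. -/
def linearForm (b : Module.Basis κ k L) : L →ₗ[k] MvPolynomial κ k := b.constr k X

@[simp] theorem linearForm_basis (i : κ) : linearForm b (b i) = X i := b.constr_basis k _ i

@[simp] theorem quantization_linearForm (x : L) : quantization b (linearForm b x) = incl k x := by
  have : quantization b ∘ₗ linearForm b = incl k :=
    b.ext fun i => by simp
  exact LinearMap.congr_fun this x

theorem linearForm_mem_span {x : L} {s : Set κ} (hx : x ∈ Submodule.span k (b '' s)) :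
    linearForm b x ∈ Submodule.span k (X '' s) := by
  have := Submodule.mem_map_of_mem (f := linearForm b) hx
  rwa [Submodule.map_span, Set.image_image, Set.image_congr fun i _ => linearForm_basis i] at this

theorem listProd_sub_quantization (h : IsAdapted b w) (l : List κ) :
    listProd b l - quantization b (listMonomial k l) ∈ filt b w (listWeight w l) := by
  classical
  rw [listMonomial_eq, quantization_monomial]
  exact listProd_perm h (exponentList_perm l).symm

/-- Homogeneous polynomials are spanned by the monomials of the given weight. -/
theorem homogeneous_induction {d : ℤ} {C : MvPolynomial κ k → Prop} (zero : C 0)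
    (add : ∀ p q, C p → C q → C (p + q)) (smul : ∀ (c : k) p, C p → C (c • p))
    (list : ∀ l, listWeight w l = d → C (listMonomial k l))
    {p : MvPolynomial κ k} (hp : p.IsWeightedHomogeneous w d) : C p := by
  induction hp using IsWeightedHomogeneous.induction_on with
  | zero => exact zero
  | add p q _ _ hp hq => exact add p q hp hq
  | monomial s r hr =>
    have : monomial s r = r • listMonomial k (exponentList s) := by
      rw [listMonomial_exponentList, smul_monomial, smul_eq_mul, mul_one]
    rw [this]
    exact smul r _ (list _ ((listWeight_exponentList w s).trans hr))

theorem quantization_mem_filt {d m : ℤ} (hm : d < m)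
    {p : MvPolynomial κ k} (hp : p.IsWeightedHomogeneous w d) : quantization b p ∈ filt b w m := by
  refine homogeneous_induction (w := w) (d := d) (C := fun p => quantization b p ∈ filt b w m)
    (by simp) (fun p q hp hq => by rw [map_add]; exact add_mem hp hq)
    (fun c p hp => by rw [map_smul]; exact Submodule.smul_mem _ c hp) (fun l hl => ?_) hp
  classical
  rw [listMonomial_eq, quantization_monomial]
  refine listProd_mem_filt ?_
  rw [listWeight_perm w (exponentList_perm l)]
  lia

/-- The quantization is multiplicative modulo terms of lower weight. -/
theorem quantization_mul (h : IsAdapted b w) {d e : ℤ} {p q : MvPolynomial κ k}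
    (hp : p.IsWeightedHomogeneous w d) (hq : q.IsWeightedHomogeneous w e) :
    quantization b p * quantization b q - quantization b (p * q) ∈ filt b w (d + e) := by
  refine homogeneous_induction (w := w) (d := d)
    (C := fun p => quantization b p * quantization b q - quantization b (p * q) ∈ filt b w (d + e))
    (by simp) (fun p p' hp hp' => ?_) (fun c p hp => ?_) (fun l hl => ?_) hp
  · convert! add_mem hp hp' using 1
    simp only [map_add, add_mul]; abel
  · convert! Submodule.smul_mem _ c hp using 1
    simp only [map_smul, smul_mul_assoc, smul_sub]
  refine homogeneous_induction (w := w) (d := e)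
    (C := fun q => quantization b (listMonomial k l) * quantization b q
      - quantization b (listMonomial k l * q) ∈ filt b w (d + e))
    (by simp) (fun p p' hp hp' => ?_) (fun c p hp => ?_) (fun l' hl' => ?_) hq
  · convert! add_mem hp hp' using 1
    simp only [map_add, mul_add]; abel
  · convert! Submodule.smul_mem _ c hp using 1
    simp only [map_smul, mul_smul_comm, smul_sub]
  have h₁ := listProd_sub_quantization h l
  have h₂ := listProd_sub_quantization h l'
  have h₃ := listProd_sub_quantization h (l ++ l')
  rw [listWeight_append, listMonomial_append, listProd_append] at h₃
  rw [hl] at h₁ h₃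
  rw [hl'] at h₂ h₃
  have h₄ : listProd b l ∈ filt b w (d + 1) := listProd_mem_filt (by lia)
  have h₅ : quantization b (listMonomial k l') ∈ filt b w (e + 1) :=
    quantization_mem_filt (lt_add_one e) (hl' ▸ listMonomial_isWeightedHomogeneous w l')
  have := sub_mem h₃ (add_mem (mul_mem_filt h₄ h₂ (t := d + e) (by lia))
    (mul_mem_filt h₁ h₅ (t := d + e) (by lia)))
  convert! this using 1
  noncomm_ring

/-- Every element has a symbol. -/
theorem exists_symbol (h : IsAdapted b w) {d : ℤ} {u : UniversalEnvelopingAlgebra k L}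
    (hu : u ∈ filt b w (d + 1)) :
    ∃ p : MvPolynomial κ k, p.IsWeightedHomogeneous w d ∧ u - quantization b p ∈ filt b w d := by
  induction hu using Submodule.span_induction with
  | mem x hx =>
    obtain ⟨l, hl, rfl⟩ := hx
    rcases (Int.lt_add_one_iff.1 hl).lt_or_eq with hl | hl
    · exact ⟨0, isWeightedHomogeneous_zero _ _ _, by simpa using listProd_mem_filt hl⟩
    · exact ⟨listMonomial k l, hl ▸ listMonomial_isWeightedHomogeneous w l,
        hl ▸ listProd_sub_quantization h l⟩
  | zero => exact ⟨0, isWeightedHomogeneous_zero _ _ _, by simp⟩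
  | add u v _ _ hu hv =>
    obtain ⟨p, hp, hu⟩ := hu
    obtain ⟨q, hq, hv⟩ := hv
    refine ⟨p + q, hp.add hq, ?_⟩
    rw [map_add, add_sub_add_comm]
    exact add_mem hu hv
  | smul c u _ hu =>
    obtain ⟨p, hp, hu⟩ := hu
    refine ⟨c • p, (weightedHomogeneousSubmodule k w d).smul_mem c hp, ?_⟩
    rw [map_smul, ← smul_sub]
    exact Submodule.smul_mem _ c hu

/-- The quantization maps onto the steps of the filtration. -/
theorem exists_quantization_eq (h : IsAdapted b w) (n : ℕ) :
    ∀ u ∈ filt b w n, ∃ p : MvPolynomial κ k,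
      (∀ s ∈ p.support, Finsupp.weight w s < (n : ℤ)) ∧ quantization b p = u := by
  classical
  induction n with
  | zero =>
    intro u hu
    rw [filt_eq_bot h.nonneg (by simp), Submodule.mem_bot] at hu
    exact ⟨0, by simp [hu]⟩
  | succ n ih =>
    intro u hu
    obtain ⟨p, hp, hu⟩ := exists_symbol h (d := n) (by simpa using hu)
    obtain ⟨q, hq, hqu⟩ := ih _ hu
    refine ⟨q + p, fun s hs => ?_, by rw [map_add, hqu]; abel⟩
    rcases Finset.mem_union.1 (support_add hs) with hs | hs
    · have := hq s hs
      push_cast; lia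
    · rw [hp (mem_support_iff.1 hs)]
      push_cast; lia

end UniversalEnvelopingAlgebra

end

noncomputable section

namespace UniversalEnvelopingAlgebra

open MvPolynomial
open scoped TensorProduct

/-! ### Derivations of weighted polynomial rings -/

section Derivation

variable {k κ : Type*} [Field k] {w : κ → ℤ}

theorem derivation_isWeightedHomogeneous
    {D : Derivation k (MvPolynomial κ k) (MvPolynomial κ k)} {c : ℤ}
    (hD : ∀ i, (D (X i)).IsWeightedHomogeneous w (w i + c)) {d : ℤ} {p : MvPolynomial κ k}
    (hp : p.IsWeightedHomogeneous w d) : (D p).IsWeightedHomogeneous w (d + c) := by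
  refine homogeneous_induction (w := w) (d := d)
    (C := fun p => (D p).IsWeightedHomogeneous w (d + c))
    (by rw [map_zero]; exact isWeightedHomogeneous_zero _ _ _)
    (fun p q hp hq => by rw [map_add]; exact hp.add hq)
    (fun c p hp => by
      rw [Derivation.map_smul]
      exact (weightedHomogeneousSubmodule k w _).smul_mem c hp) (fun l hl => ?_) hp
  subst hl
  clear hp
  induction l with
  | nil => rw [listMonomial_nil, Derivation.map_one_eq_zero]; exact isWeightedHomogeneous_zero _ _ _
  | cons i l ih =>
    rw [listMonomial_cons, Derivation.leibniz, listWeight_cons, smul_eq_mul, smul_eq_mul]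
    have hl := listMonomial_isWeightedHomogeneous (k := k) w l
    refine IsWeightedHomogeneous.add ?_ ?_
    · convert! (isWeightedHomogeneous_X k w i).mul ih using 1
      ring
    · convert! hl.mul (hD i) using 1
      ring

/-- A monomial of nonzero weight contains a variable of nonzero weight. Differentiating in it
multiplies the coefficient by a positive exponent, which is invertible in characteristic zero. -/
theorem eq_zero_of_pderiv_eq_zero [CharZero k] {d : ℤ} {p : MvPolynomial κ k}
    (hp : p.IsWeightedHomogeneous w d) (hd : d ≠ 0) (h : ∀ i, w i ≠ 0 → pderiv i p = 0) :
    p = 0 := by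
  ext s
  rw [coeff_zero]
  by_contra hs
  have hw := hp hs
  rw [Finsupp.weight_apply] at hw
  obtain ⟨i, hi⟩ : ∃ i, s i ≠ 0 ∧ w i ≠ 0 := by
    by_contra! hi
    refine hd (hw ▸ Finset.sum_eq_zero fun i hi' => ?_)
    simp [hi i (Finsupp.mem_support_iff.1 hi')]
  have := congrArg (coeff (s - Finsupp.single i 1)) (h i hi.2)
  rw [coeff_pderiv, coeff_zero, tsub_add_cancel_of_le] at this
  · have h1 : s i - 1 + 1 = s i := Nat.sub_add_cancel (Nat.pos_of_ne_zero hi.1)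
    refine (mul_ne_zero hs ?_) this
    exact Nat.cast_add_one_ne_zero _
  · simpa [Nat.one_le_iff_ne_zero] using hi.1

/-- The component of top weight of a polynomial. -/
theorem exists_top_component {n : ℕ} {p : MvPolynomial κ k}
    (hp : ∀ s ∈ p.support, Finsupp.weight w s < ((n + 1 : ℕ) : ℤ)) :
    ∃ p₀ p₁ : MvPolynomial κ k, p₀.IsWeightedHomogeneous w n ∧
      (∀ s ∈ p₁.support, Finsupp.weight w s < (n : ℤ)) ∧ p = p₀ + p₁ := by
  refine ⟨weightedHomogeneousComponent w (n : ℤ) p, p - weightedHomogeneousComponent w (n : ℤ) p,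
    weightedHomogeneousComponent_isWeightedHomogeneous _ _, fun s hs => ?_, by abel⟩
  rw [mem_support_iff, coeff_sub, coeff_weightedHomogeneousComponent] at hs
  split_ifs at hs with h
  · simp at hs
  · rw [sub_zero, ← mem_support_iff] at hs
    have := hp s hs
    push_cast at this
    lia

end Derivation

/-! ### The comultiplication -/

section Comul

variable {k L κ : Type*} [Field k] [LieRing L] [LieAlgebra k L]

local notation "U" => UniversalEnvelopingAlgebra k L

variable (k L) in
/-- The algebra map `U(L) → U(L) ⊗ U(L)` for which the elements of `L` are primitive. -/
def comul : U →ₐ[k] U ⊗[k] U :=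
  letI : LieRing (U ⊗[k] U) := LieRing.ofAssociativeRing
  lift k
    { toFun x := incl k x ⊗ₜ 1 + 1 ⊗ₜ incl k x
      map_add' x y := by
        rw [map_add, TensorProduct.add_tmul, TensorProduct.tmul_add]; abel
      map_smul' c x := by
        rw [map_smul, ← TensorProduct.smul_tmul', TensorProduct.tmul_smul, ← smul_add]; rfl
      map_lie' {x y} := by
        rw [LieRing.of_associative_ring_bracket, incl_bracket]
        simp only [add_mul, mul_add, Algebra.TensorProduct.tmul_mul_tmul, one_mul, mul_one,
          TensorProduct.sub_tmul, TensorProduct.tmul_sub]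
        abel }

theorem comul_incl (x : L) : comul k L (incl k x) = incl k x ⊗ₜ 1 + 1 ⊗ₜ incl k x := by
  let _ : LieRing (U ⊗[k] U) := LieRing.ofAssociativeRing
  exact lift_ι_apply k _ x

/-- Contraction of the first tensor factor of the comultiplication with a linear form. -/
def contract (f : U →ₗ[k] k) : U →ₗ[k] U :=
  (TensorProduct.lid k U).toLinearMap ∘ₗ f.rTensor U ∘ₗ (comul k L).toLinearMap

theorem contract_one (f : U →ₗ[k] k) : contract f 1 = f 1 • (1 : U) := by
  simp [contract, Algebra.TensorProduct.one_def]

theorem contract_incl_mul (f : U →ₗ[k] k) (x : L) (u : U) :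
    contract f (incl k x * u) =
      contract (f ∘ₗ LinearMap.mulLeft k (incl k x)) u + incl k x * contract f u := by
  simp only [contract, LinearMap.comp_apply, AlgHom.toLinearMap_apply, map_mul, comul_incl]
  induction comul k L u using TensorProduct.induction_on with
  | zero => simp
  | tmul a c => simp [add_mul]
  | add s t hs ht =>
    simp only [mul_add, map_add, hs, ht]
    abel

variable {b : Module.Basis κ k L}

/-- In the comultiplication of `x₁ ⋯ xₙ`, every term except `1 ⊗ x₁ ⋯ xₙ` has fewer than `n` letters
in its second factor. -/
theorem contract_listProd_sub_smul (l : List κ) :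
    ∀ f : U →ₗ[k] k, contract f (listProd b l) - f 1 • listProd b l ∈ filt b 1 (l.length : ℤ) := by
  induction l with
  | nil => intro f; simp [contract_one]
  | cons i l ih =>
    intro f
    have hl : listProd b l ∈ filt b 1 ((l.length : ℤ) + 1) :=
      listProd_mem_filt (by rw [listWeight_one]; exact lt_add_one _)
    have h₁ : contract (f ∘ₗ LinearMap.mulLeft k (incl k (b i))) (listProd b l) ∈
        filt b 1 ((l.length : ℤ) + 1) := by
      have := add_mem (filt_mono (by lia) (ih (f ∘ₗ LinearMap.mulLeft k (incl k (b i)))))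
        (Submodule.smul_mem _ ((f ∘ₗ LinearMap.mulLeft k (incl k (b i))) 1) hl)
      simpa using this
    have h₂ := mul_mem_filt (incl_basis_mem_filt (b := b) (w := 1) i) (ih f)
      (t := (l.length : ℤ) + 1) (by simp only [Pi.one_apply]; lia)
    convert! add_mem h₁ h₂ using 1
    · rw [listProd_cons, contract_incl_mul, mul_sub, mul_smul_comm]; abel

/-- The derivation of the polynomial ring attached to a linear form on `U(L)`. -/
def formDerivation (b : Module.Basis κ k L) (f : U →ₗ[k] k) :
    Derivation k (MvPolynomial κ k) (MvPolynomial κ k) :=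
  mkDerivation k fun i => C (f (incl k (b i)))

theorem formDerivation_X (f : U →ₗ[k] k) (i : κ) :
    formDerivation b f (X i) = C (f (incl k (b i))) :=
  mkDerivation_X _ _ _

theorem formDerivation_isWeightedHomogeneous (f : U →ₗ[k] k) {d : ℤ} {p : MvPolynomial κ k}
    (hp : p.IsWeightedHomogeneous 1 d) :
    (formDerivation b f p).IsWeightedHomogeneous 1 (d - 1) :=
  derivation_isWeightedHomogeneous (c := -1) (fun i => by
    rw [formDerivation_X]; exact isWeightedHomogeneous_C 1 _) hp

/-- Contraction with a linear form that vanishes at `1` has a derivation as its symbol. -/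
theorem contract_listProd_sub_quantization {f : U →ₗ[k] k} (hf : f 1 = 0) (l : List κ) :
    contract f (listProd b l) - quantization b (formDerivation b f (listMonomial k l)) ∈
      filt b 1 ((l.length : ℤ) - 1) := by
  induction l with
  | nil => simp [contract_one, hf]
  | cons i l ih =>
    have hM := listMonomial_isWeightedHomogeneous (k := k) 1 l
    rw [listWeight_one] at hM
    set f' := f ∘ₗ LinearMap.mulLeft k (incl k (b i)) with hf'
    have h₁ := contract_listProd_sub_smul (b := b) l f'
    have h₂ := listProd_sub_quantization (isAdapted_one b) l
    rw [listWeight_one] at h₂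
    have h₃ := mul_mem_filt (incl_basis_mem_filt (b := b) (w := 1) i) ih
      (t := (l.length : ℤ)) (by simp only [Pi.one_apply]; lia)
    have h₄ := quantization_mul (isAdapted_one b) (isWeightedHomogeneous_X k 1 i)
      (formDerivation_isWeightedHomogeneous (b := b) f hM)
    have hone : (1 : κ → ℤ) i + ((l.length : ℤ) - 1) = l.length := by simp
    rw [hone, quantization_X] at h₄
    have h1 : f' 1 = f (incl k (b i)) := by simp [hf']
    rw [h1] at h₁
    have h₅ := add_mem (add_mem h₁ (Submodule.smul_mem _ (f (incl k (b i))) h₂)) (add_mem h₃ h₄)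
    convert! h₅ using 1
    · simp
    · rw [listProd_cons, contract_incl_mul, listMonomial_cons, Derivation.leibniz,
        formDerivation_X, smul_eq_mul, smul_eq_mul, mul_comm (listMonomial k l), ← smul_eq_C_mul,
        map_add, map_smul, smul_sub, mul_sub]
      abel

theorem contract_mem_filt {f : U →ₗ[k] k} (hf : f 1 = 0) {m : ℤ} {u : U}
    (hu : u ∈ filt b 1 (m + 1)) : contract f u ∈ filt b 1 m := by
  induction hu using Submodule.span_induction with
  | mem x hx =>
    obtain ⟨l, hl, rfl⟩ := hx
    have hM := listMonomial_isWeightedHomogeneous (k := k) 1 l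
    have hl' : listWeight 1 l < m + 1 := hl
    rw [listWeight_one] at hM hl'
    have := add_mem (filt_mono (n := m) (by lia) (contract_listProd_sub_quantization (b := b) hf l))
      (quantization_mem_filt (m := m) (by lia) (formDerivation_isWeightedHomogeneous (b := b) f hM))
    simpa using this
  | zero => simp
  | add x y _ _ hx hy => rw [map_add]; exact add_mem hx hy
  | smul c x _ hx => rw [map_smul]; exact Submodule.smul_mem _ c hx

theorem contract_quantization {f : U →ₗ[k] k} (hf : f 1 = 0) {d : ℤ} {p : MvPolynomial κ k}
    (hp : p.IsWeightedHomogeneous 1 d) :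
    contract f (quantization b p) - quantization b (formDerivation b f p) ∈ filt b 1 (d - 1) := by
  refine homogeneous_induction (w := 1) (d := d) (C := fun p => contract f (quantization b p) -
    quantization b (formDerivation b f p) ∈ filt b 1 (d - 1)) (by simp)
    (fun p q hp hq => ?_) (fun c p hp => ?_) (fun l hl => ?_) hp
  · convert! add_mem hp hq using 1
    simp only [map_add]; abel
  · convert! Submodule.smul_mem _ c hp using 1
    rw [Derivation.map_smul]
    simp only [map_smul, smul_sub]
  · have h₁ := contract_listProd_sub_quantization (b := b) hf l
    have h₂ := contract_mem_filt (m := d - 1) hf (by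
      rw [sub_add_cancel, ← hl]; exact listProd_sub_quantization (isAdapted_one b) l)
    rw [← listWeight_one, hl] at h₁
    convert! sub_mem h₁ h₂ using 1
    rw [map_sub]; abel

variable (k L) in
/-- The augmentation of `U(L)`. -/
def augmentation : U →ₐ[k] k :=
  letI : LieRing k := LieRing.ofAssociativeRing
  lift k (0 : L →ₗ⁅k⁆ k)

theorem augmentation_incl (x : L) : augmentation k L (incl k x) = 0 := by
  let _ : LieRing k := LieRing.ofAssociativeRing
  exact lift_ι_apply k _ x

instance : Nontrivial U := (augmentation k L).toRingHom.domain_nontrivial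

/-- A linear retraction of `U(L)` onto `L` extends the coordinate `i` to `U(L)`. Subtracting a
multiple of the augmentation makes it vanish at `1` without changing it on `L`. -/
theorem exists_coordinate_form (hι : Function.Injective (incl k : L → U)) (i : κ) :
    ∃ f : U →ₗ[k] k, f 1 = 0 ∧ formDerivation b f = pderiv i := by
  classical
  obtain ⟨g, hg⟩ := (incl k : L →ₗ[k] U).exists_leftInverse_of_injective (LinearMap.ker_eq_bot.2 hι)
  refine ⟨b.coord i ∘ₗ g - b.coord i (g 1) • (augmentation k L).toLinearMap, by simp, ?_⟩
  refine derivation_ext fun j => ?_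
  have := LinearMap.congr_fun hg (b j)
  simp only [LinearMap.comp_apply, LinearMap.id_apply] at this
  rw [formDerivation_X, pderiv_X]
  simp [augmentation_incl, this, Finsupp.single_apply, Pi.single_apply, eq_comm]

variable {w : κ → ℤ}

/-- Take the first step of the filtration that contains `u`; a zero symbol would put `u` one step
lower. -/
theorem exists_nonzero_symbol (h : IsAdapted b w) {u : U} (hu : u ≠ 0) :
    ∃ d : ℕ, u ∈ filt b w (d + 1) ∧ ∃ p : MvPolynomial κ k, p.IsWeightedHomogeneous w (d : ℤ) ∧
      p ≠ 0 ∧ u - quantization b p ∈ filt b w d := by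
  classical
  have hex := exists_mem_filt b w u
  have h0 : Nat.find hex ≠ 0 := fun h0 => hu (by
    have := Nat.find_spec hex
    rwa [h0, Nat.cast_zero, filt_eq_bot h.nonneg le_rfl, Submodule.mem_bot] at this)
  obtain ⟨d, hd⟩ := Nat.exists_eq_succ_of_ne_zero h0
  have hud : u ∈ filt b w ((d : ℤ) + 1) := by
    have := Nat.find_spec hex
    rw [hd] at this
    simpa using this
  obtain ⟨p, hp, hup⟩ := exists_symbol h hud
  refine ⟨d, hud, p, hp, ?_, hup⟩
  rintro rfl
  rw [map_zero, sub_zero] at hup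
  exact Nat.find_min hex (m := d) (by lia) hup

/-! ### Poincaré–Birkhoff–Witt and the absence of zero divisors -/

variable [CharZero k]

/-- Contraction with the `i`-th coordinate form lowers the filtration by one and replaces the symbol
`p` by its `i`-th partial derivative. By induction all partial derivatives vanish, hence so does
`p`. -/
theorem eq_zero_of_quantization_mem_filt_one (hι : Function.Injective (incl k : L → U)) (n : ℕ) :
    ∀ p : MvPolynomial κ k, p.IsWeightedHomogeneous (1 : κ → ℤ) n →
      quantization b p ∈ filt b 1 (n : ℤ) → p = 0 := by
  induction n with
  | zero =>
    intro p hp hpf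
    rw [Nat.cast_zero, filt_eq_bot (w := 1) (fun _ => zero_le_one) le_rfl, Submodule.mem_bot] at hpf
    have hC : p = C (coeff 0 p) := by
      classical
      ext s
      rw [coeff_C]
      split_ifs with h
      · rw [h]
      · refine hp.coeff_eq_zero s fun h0 => h ?_
        have : listWeight 1 (exponentList s) = 0 := (listWeight_exponentList 1 s).trans h0
        rw [listWeight_one, Nat.cast_eq_zero, List.length_eq_zero_iff, exponentList,
          Multiset.toList_eq_nil] at this
        have := congrArg Multiset.toFinsupp this
        rw [Finsupp.toMultiset_toFinsupp, map_zero] at this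
        exact this.symm
    rw [hC, ← mul_one (C _), ← smul_eq_C_mul, map_smul, quantization_one, smul_eq_zero] at hpf
    rw [hC, hpf.resolve_right one_ne_zero, C_0]
  | succ n ih =>
    intro p hp hpf
    refine eq_zero_of_pderiv_eq_zero hp (by positivity) fun i _ => ?_
    obtain ⟨f, hf, hfi⟩ := exists_coordinate_form (b := b) hι i
    have hd := formDerivation_isWeightedHomogeneous (b := b) f hp
    have h₁ := contract_quantization (b := b) hf hp
    have h₂ := contract_mem_filt (m := n) hf (by simpa using hpf)
    rw [hfi] at hd h₁
    simp only [Nat.cast_add, Nat.cast_one, add_sub_cancel_right] at hd h₁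
    exact ih _ hd (by simpa using sub_mem h₂ h₁)

/-- **Poincaré–Birkhoff–Witt** in characteristic zero, for a Lie algebra that embeds in its
enveloping algebra. -/
theorem quantization_injective (hι : Function.Injective (incl k : L → U)) :
    Function.Injective (quantization b) := by
  have key (n : ℕ) : ∀ p : MvPolynomial κ k,
      (∀ s ∈ p.support, Finsupp.weight (1 : κ → ℤ) s < (n : ℤ)) → quantization b p = 0 → p = 0 := by
    induction n with
    | zero =>
      intro p hp _
      rw [← support_eq_empty, Finset.eq_empty_iff_forall_notMem]
      intro s hs
      have := hp s hs
      rw [← listWeight_exponentList] at this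
      exact absurd this (not_lt.2 (listWeight_nonneg (fun _ => zero_le_one) _))
    | succ n ih =>
      intro p hp hp0
      obtain ⟨p₀, p₁, h₀, h₁, rfl⟩ := exists_top_component hp
      have : quantization b p₁ ∈ filt b 1 (n : ℤ) := by
        have hs : p₁ = ∑ s ∈ p₁.support, coeff s p₁ • monomial s 1 := by
          conv_lhs => rw [as_sum p₁]
          simp [smul_monomial]
        rw [hs, map_sum]
        refine sum_mem fun s hs => ?_
        rw [map_smul]
        exact Submodule.smul_mem _ _
          (quantization_mem_filt (h₁ s hs) (isWeightedHomogeneous_monomial _ s _ rfl))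
      rw [map_add] at hp0
      have hz : p₀ = 0 := eq_zero_of_quantization_mem_filt_one hι n p₀ h₀ (by
        rw [eq_neg_of_add_eq_zero_left hp0]; exact neg_mem this)
      rw [hz, zero_add]
      rw [hz, map_zero, zero_add] at hp0
      exact ih _ h₁ hp0
  rw [injective_iff_map_eq_zero]
  intro p hp
  refine key ((p.support.sup fun s => (Finsupp.weight (1 : κ → ℤ) s).toNat) + 1) p (fun s hs => ?_) hp
  have := Finset.le_sup (f := fun s => (Finsupp.weight (1 : κ → ℤ) s).toNat) hs
  push_cast
  lia

/-- A nonzero homogeneous polynomial is the symbol of its quantization. -/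
theorem eq_zero_of_quantization_mem_filt (hι : Function.Injective (incl k : L → U))
    (h : IsAdapted b w) {d : ℤ} {p : MvPolynomial κ k} (hp : p.IsWeightedHomogeneous w d)
    (hpd : quantization b p ∈ filt b w d) : p = 0 := by
  rcases lt_or_ge d 0 with hd | hd
  · rw [filt_eq_bot h.nonneg hd.le, Submodule.mem_bot] at hpd
    exact quantization_injective hι (hpd.trans (map_zero _).symm)
  · lift d to ℕ using hd
    -- A second preimage `q` with all weights below `d` must equal `p` by injectivity, while `p`
    -- only has weight `d`.
    obtain ⟨q, hq, hqp⟩ := exists_quantization_eq h d _ hpd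
    obtain rfl := quantization_injective hι hqp
    rw [← support_eq_empty, Finset.eq_empty_iff_forall_notMem]
    intro s hs
    exact (hq s hs).ne (hp (mem_support_iff.1 hs))

/-- The symbol of a product is the product of the symbols, and polynomials over a field have no zero
divisors. -/
theorem mul_ne_zero_of_incl_injective (b : Module.Basis κ k L)
    (hι : Function.Injective (incl k : L → U)) {u v : U} (hu : u ≠ 0) (hv : v ≠ 0) :
    u * v ≠ 0 := by
  have h := isAdapted_one b
  obtain ⟨d, hud, p, hp, hp0, hup⟩ := exists_nonzero_symbol h hu
  obtain ⟨e, hve, q, hq, hq0, hvq⟩ := exists_nonzero_symbol h hv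
  intro huv
  refine mul_ne_zero hp0 hq0 (eq_zero_of_quantization_mem_filt hι h (hp.mul hq) ?_)
  have h₁ := quantization_mul h hp hq
  have h₂ := mul_mem_filt hup hve (t := (d : ℤ) + e) (by lia)
  have h₃ := mul_mem_filt (quantization_mem_filt (b := b) (lt_add_one _) hp) hvq
    (t := (d : ℤ) + e) (by lia)
  have := neg_mem (add_mem h₁ (add_mem h₂ h₃))
  convert! this using 1
  have : -(quantization b p * quantization b q - quantization b (p * q) +
      ((u - quantization b p) * v + quantization b p * (v - quantization b q))) =
      quantization b (p * q) - u * v := by noncomm_ring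
  rw [this, huv, sub_zero]

theorem isDomain_of_incl_injective (hι : Function.Injective (incl k : L → U)) : IsDomain U :=
  have : NoZeroDivisors U := ⟨fun {u v} huv => by
    by_contra! h
    exact mul_ne_zero_of_incl_injective (Module.Basis.ofVectorSpace k L) hι h.1 h.2 huv⟩
  NoZeroDivisors.to_isDomain _

end Comul

end UniversalEnvelopingAlgebra

end

noncomputable section

namespace UniversalEnvelopingAlgebra

open MvPolynomial

/-! ### The Ore condition -/

section Ore

variable {k L κ : Type*} [Field k] [LieRing L] [LieAlgebra k L]

local notation "U" => UniversalEnvelopingAlgebra k L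

/-- A monomial of degree less than `n` has all exponents below `n`, so `n ^ card κ` generators
suffice. This crude bound is the polynomial growth used for the Ore condition. -/
theorem filt_one_le_span_range [Fintype κ] (b : Module.Basis κ k L) (n : ℕ) :
    filt b 1 (n : ℤ) ≤ Submodule.span k (Set.range fun e : κ → Fin n =>
      quantization b (monomial (Finsupp.equivFunOnFinite.symm fun i => (e i : ℕ)) 1)) := by
  intro u hu
  obtain ⟨p, hp, rfl⟩ := exists_quantization_eq (isAdapted_one b) n u hu
  rw [as_sum p, map_sum]
  refine sum_mem fun s hs => ?_
  have hs' : ∀ i, s i < n := fun i => by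
    have := hp s hs
    rw [Finsupp.weight_apply, Finsupp.sum_fintype _ _ (by simp)] at this
    simp only [Pi.one_apply, nsmul_eq_mul, mul_one] at this
    have hi := Finset.single_le_sum (f := fun i => (s i : ℤ)) (fun _ _ => by positivity)
      (Finset.mem_univ i)
    exact_mod_cast hi.trans_lt this
  have : monomial s (coeff s p) = coeff s p • monomial s (1 : k) := by
    rw [smul_monomial, smul_eq_mul, mul_one]
  rw [this, map_smul]
  exact Submodule.smul_mem _ _ (Submodule.subset_span ⟨fun i => ⟨s i, hs' i⟩,
    congrArg (fun t => quantization b (monomial t 1)) (Finsupp.ext fun _ => rfl)⟩)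

theorem finiteDimensional_filt_one [Fintype κ] (b : Module.Basis κ k L) (n : ℕ) :
    FiniteDimensional k (filt b 1 (n : ℤ)) := by
  have := FiniteDimensional.span_of_finite k (Set.finite_range fun e : κ → Fin n =>
      quantization b (monomial (Finsupp.equivFunOnFinite.symm fun i => (e i : ℕ)) 1))
  exact Submodule.finiteDimensional_of_le (filt_one_le_span_range b n)

theorem finrank_filt_one_le [Fintype κ] (b : Module.Basis κ k L) (n : ℕ) :
    Module.finrank k (filt b 1 (n : ℤ)) ≤ n ^ Fintype.card κ := by
  classical
  have := FiniteDimensional.span_of_finite k (Set.finite_range fun e : κ → Fin n =>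
      quantization b (monomial (Finsupp.equivFunOnFinite.symm fun i => (e i : ℕ)) 1))
  refine (Submodule.finrank_mono (filt_one_le_span_range b n)).trans
    ((finrank_range_le_card _).trans ?_)
  simp

theorem exists_pow_lt_two_pow (p N : ℕ) : ∃ j : ℕ, (1 + j * p) ^ N < 2 ^ j := by
  have h := tendsto_pow_const_div_const_pow_of_one_lt (r := (2 : ℝ)) N one_lt_two
  have hpos : (0 : ℝ) < 1 / (1 + p) ^ N := by positivity
  obtain ⟨j, hj, hj1⟩ := ((h.eventually (gt_mem_nhds hpos)).and
    (Filter.eventually_ge_atTop 1)).exists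
  refine ⟨j, ?_⟩
  rw [div_lt_div_iff₀ (by positivity) (by positivity), one_mul, ← mul_pow] at hj
  have h1 : (1 + j * p) ^ N ≤ (j * (1 + p)) ^ N := Nat.pow_le_pow_left (by nlinarith) N
  have h2 : (j * (1 + p)) ^ N < 2 ^ j := by exact_mod_cast hj
  exact h1.trans_lt h2

/-- `U(L)` satisfies the left Ore condition by polynomial growth, if it is a domain. -/
theorem exists_common_left_multiple [FiniteDimensional k L] [IsDomain U] (a : U) {s : U}
    (hs : s ≠ 0) : ∃ r t : U, t ≠ 0 ∧ t * a = r * s := by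
  by_cases ha : a = 0
  · exact ⟨0, 1, one_ne_zero, by simp [ha]⟩
  by_contra! hno
  let b := Module.finBasis k L
  have : ∀ n : ℕ, FiniteDimensional k (filt b 1 (n : ℤ)) := finiteDimensional_filt_one b
  obtain ⟨p₁, hp₁⟩ := exists_mem_filt b 1 a
  obtain ⟨p₂, hp₂⟩ := exists_mem_filt b 1 s
  obtain ⟨p, hap, hsp⟩ : ∃ p : ℕ, a ∈ filt b 1 (p : ℤ) ∧ s ∈ filt b 1 (p : ℤ) :=
    ⟨p₁ + p₂, filt_mono (by push_cast; lia) hp₁, filt_mono (by push_cast; lia) hp₂⟩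
  -- Without a common left multiple, right multiplication by `a` and by `s` gives two independent
  -- copies of step `n` inside step `n + p`. Iteration makes the dimensions grow exponentially.
  have hdouble (n : ℕ) : 2 * Module.finrank k (filt b 1 (n : ℤ)) ≤
      Module.finrank k (filt b 1 ((n + p : ℕ) : ℤ)) := by
    have hinj {c : U} (hc : c ≠ 0) : Function.Injective (LinearMap.mulRight k c) :=
      fun _ _ h => mul_right_cancel₀ hc h
    have hle {c : U} (hc : c ∈ filt b 1 (p : ℤ)) :
        (filt b 1 (n : ℤ)).map (LinearMap.mulRight k c) ≤ filt b 1 ((n + p : ℕ) : ℤ) := by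
      rintro _ ⟨u, hu, rfl⟩
      exact mul_mem_filt hu hc (by push_cast; lia)
    have hdisj : (filt b 1 (n : ℤ)).map (LinearMap.mulRight k a) ⊓
        (filt b 1 (n : ℤ)).map (LinearMap.mulRight k s) = ⊥ := by
      rw [Submodule.eq_bot_iff]
      rintro _ ⟨⟨t, _, rfl⟩, ⟨r, _, hr⟩⟩
      by_contra h0
      refine hno r t (fun ht => h0 (by simp [ht])) ?_
      simpa using hr.symm
    have hrank := Submodule.finrank_sup_add_finrank_inf_eq
      ((filt b 1 (n : ℤ)).map (LinearMap.mulRight k a))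
      ((filt b 1 (n : ℤ)).map (LinearMap.mulRight k s))
    rw [hdisj, finrank_bot, ← (Submodule.equivMapOfInjective _ (hinj ha) _).finrank_eq,
      ← (Submodule.equivMapOfInjective _ (hinj hs) _).finrank_eq] at hrank
    have := Submodule.finrank_mono (sup_le (hle hap) (hle hsp))
    lia
  have hpow (j : ℕ) : 2 ^ j ≤ Module.finrank k (filt b 1 ((1 + j * p : ℕ) : ℤ)) := by
    induction j with
    | zero =>
      have h1 : (1 : U) ∈ filt b 1 ((1 + 0 * p : ℕ) : ℤ) := listProd_mem_filt (l := []) (by simp)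
      have : Nontrivial (filt b 1 ((1 + 0 * p : ℕ) : ℤ)) :=
        ⟨⟨⟨1, h1⟩, 0, fun h => one_ne_zero (congrArg Subtype.val h)⟩⟩
      exact Module.finrank_pos
    | succ j ih =>
      have := hdouble (1 + j * p)
      rw [show 1 + (j + 1) * p = 1 + j * p + p by ring, pow_succ]
      lia
  obtain ⟨j, hj⟩ := exists_pow_lt_two_pow p (Fintype.card (Fin (Module.finrank k L)))
  exact absurd ((hpow j).trans (finrank_filt_one_le b _)) (not_le.2 hj)

theorem nonempty_oreSet [FiniteDimensional k L] [IsDomain U] :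
    Nonempty (OreLocalization.OreSet U⁰) := by
  rw [OreLocalization.nonempty_oreSet_iff_of_noZeroDivisors]
  intro r s
  obtain ⟨r', t, ht, h⟩ := exists_common_left_multiple r (nonZeroDivisors.ne_zero s.2)
  exact ⟨r', ⟨t, mem_nonZeroDivisors_of_ne_zero ht⟩, h⟩

end Ore

end UniversalEnvelopingAlgebra

end

noncomputable section

namespace UniversalEnvelopingAlgebra

open MvPolynomial

/-! ### Commutators with elements of weight zero -/

section Bracket

variable {k L κ : Type*} [Field k] [LieRing L] [LieAlgebra k L]
  {b : Module.Basis κ k L} {w : κ → ℤ}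

local notation "U" => UniversalEnvelopingAlgebra k L

/-- The derivation of the polynomial ring that extends the map `x ↦ [x, y]` of `L`. -/
def bracketDerivation (b : Module.Basis κ k L) (y : L) :
    Derivation k (MvPolynomial κ k) (MvPolynomial κ k) :=
  mkDerivation k fun i => linearForm b ⁅b i, y⁆

@[simp] theorem bracketDerivation_X (y : L) (i : κ) :
    bracketDerivation b y (X i) = linearForm b ⁅b i, y⁆ :=
  mkDerivation_X _ _ _

theorem linearForm_isWeightedHomogeneous {x : L} {d : ℤ}
    (hx : x ∈ Submodule.span k (b '' {l | w l = d})) :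
    (linearForm b x).IsWeightedHomogeneous w d := by
  have := linearForm_mem_span hx
  refine (Submodule.span_le (p := weightedHomogeneousSubmodule k w d)).2 ?_ this
  rintro _ ⟨i, hi, rfl⟩
  exact (show w i = d from hi) ▸ isWeightedHomogeneous_X k w i

variable {y : L} (hy : ∀ i, ⁅b i, y⁆ ∈ Submodule.span k (b '' {l | w l = w i - 1}))

include hy

theorem bracketDerivation_isWeightedHomogeneous {d : ℤ} {p : MvPolynomial κ k}
    (hp : p.IsWeightedHomogeneous w d) :
    (bracketDerivation b y p).IsWeightedHomogeneous w (d - 1) :=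
  derivation_isWeightedHomogeneous (c := -1) (fun i => by
    rw [bracketDerivation_X]; exact linearForm_isWeightedHomogeneous (hy i)) hp

/-- By `hy`, bracketing with `y` lowers each weight by exactly one. The Leibniz rule holds on both
sides, and reordering factors only produces terms of still lower weight. -/
theorem listProd_bracket (h : IsAdapted b w) (l : List κ) :
    listProd b l * incl k y - incl k y * listProd b l -
      quantization b (bracketDerivation b y (listMonomial k l)) ∈
        filt b w (listWeight w l - 1) := by
  induction l with
  | nil => simp
  | cons i l ih =>
    have hM := listMonomial_isWeightedHomogeneous (k := k) w l
    have hD := linearForm_isWeightedHomogeneous (hy i)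
    have h₁ := mul_mem_filt (incl_basis_mem_filt (b := b) (w := w) i) ih
      (t := w i + listWeight w l - 1) (by lia)
    have h₂ := quantization_mul h (isWeightedHomogeneous_X k w i)
      (bracketDerivation_isWeightedHomogeneous hy hM)
    have h₃ := mul_mem_filt (quantization_mem_filt (b := b) (lt_add_one _) hD)
      (listProd_sub_quantization h l) (t := w i + listWeight w l - 1) (by lia)
    have h₄ := quantization_mul h hD hM
    rw [quantization_X, ← add_sub_assoc] at h₂
    rw [sub_add_eq_add_sub] at h₄
    rw [quantization_linearForm] at h₃ h₄
    have h₅ := add_mem (add_mem h₁ h₂) (add_mem h₃ h₄)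
    rw [listWeight_cons]
    convert! h₅ using 1
    rw [listMonomial_cons, Derivation.leibniz, listProd_cons, bracketDerivation_X, smul_eq_mul,
      smul_eq_mul, mul_comm (listMonomial k l), map_add, incl_bracket]
    noncomm_ring

theorem bracket_mem_filt (h : IsAdapted b w) {m : ℤ} {u : U} (hu : u ∈ filt b w m) :
    u * incl k y - incl k y * u ∈ filt b w (m - 1) := by
  induction hu using Submodule.span_induction with
  | mem x hx =>
    obtain ⟨l, hl, rfl⟩ := hx
    have hl : listWeight w l < m := hl
    have hM := listMonomial_isWeightedHomogeneous (k := k) w l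
    have := add_mem (filt_mono (n := m - 1) (by lia) (listProd_bracket hy h l))
      (quantization_mem_filt (m := m - 1) (by lia) (bracketDerivation_isWeightedHomogeneous hy hM))
    rwa [sub_add_cancel] at this
  | zero => simp
  | add u v _ _ hu hv =>
    convert! add_mem hu hv using 1
    noncomm_ring
  | smul c u _ hu =>
    convert! Submodule.smul_mem _ c hu using 1
    simp only [smul_mul_assoc, mul_smul_comm, smul_sub]

theorem quantization_bracket (h : IsAdapted b w) {d : ℤ} {p : MvPolynomial κ k}
    (hp : p.IsWeightedHomogeneous w d) :
    quantization b p * incl k y - incl k y * quantization b p -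
      quantization b (bracketDerivation b y p) ∈ filt b w (d - 1) := by
  refine homogeneous_induction (w := w) (d := d)
    (C := fun p => quantization b p * incl k y - incl k y * quantization b p -
      quantization b (bracketDerivation b y p) ∈ filt b w (d - 1)) (by simp)
    (fun p q hp hq => ?_) (fun c p hp => ?_) (fun l hl => ?_) hp
  · convert! add_mem hp hq using 1
    simp only [map_add]; noncomm_ring
  · convert! Submodule.smul_mem _ c hp using 1
    rw [Derivation.map_smul]
    simp only [map_smul, smul_sub, smul_mul_assoc, mul_smul_comm]
  · have h₁ := listProd_bracket hy h l
    have h₂ := bracket_mem_filt hy h (listProd_sub_quantization h l)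
    rw [hl] at h₁ h₂
    convert! sub_mem h₁ h₂ using 1
    noncomm_ring

/-- The symbol of an element that commutes with `y` is killed by the bracket with `y`. -/
theorem bracketDerivation_eq_zero [CharZero k] (hι : Function.Injective (incl k : L → U))
    (h : IsAdapted b w) {d : ℤ} {p : MvPolynomial κ k}
    (hp : p.IsWeightedHomogeneous w d) {u : U} (hu : u - quantization b p ∈ filt b w d)
    (hc : u * incl k y = incl k y * u) : bracketDerivation b y p = 0 := by
  refine eq_zero_of_quantization_mem_filt hι h (bracketDerivation_isWeightedHomogeneous hy hp) ?_
  have := neg_mem (add_mem (bracket_mem_filt hy h hu) (quantization_bracket hy h hp))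
  convert! this using 1
  -- The terms in `quantization b p` cancel, leaving only commutators of `u` with `y`, which vanish
  -- by `hc`.
  have : quantization b (bracketDerivation b y p) + (u * incl k y - incl k y * u) =
    -((u - quantization b p) * incl k y - incl k y * (u - quantization b p) +
      (quantization b p * incl k y - incl k y * quantization b p -
      quantization b (bracketDerivation b y p))) + 2 • (u * incl k y - incl k y * u) := by
    noncomm_ring
  simpa [hc] using this

end Bracket

/-! ### The weight-zero step, where quantization is exactly multiplicative -/

section WeightZero

variable {k L κ : Type*} [Field k] [LieRing L] [LieAlgebra k L]
  {b : Module.Basis κ k L} {w : κ → ℤ}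

local notation "U" => UniversalEnvelopingAlgebra k L

theorem exists_quantization_of_mem_filt_one (h : IsAdapted b w) {u : U} (hu : u ∈ filt b w 1) :
    ∃ p : MvPolynomial κ k, p.IsWeightedHomogeneous w 0 ∧ quantization b p = u := by
  obtain ⟨p, hp, hup⟩ := exists_symbol h (d := 0) hu
  rw [filt_eq_bot h.nonneg le_rfl, Submodule.mem_bot, sub_eq_zero] at hup
  exact ⟨p, hp, hup.symm⟩

theorem quantization_mul_of_weight_zero (h : IsAdapted b w) {p q : MvPolynomial κ k}
    (hp : p.IsWeightedHomogeneous w 0) (hq : q.IsWeightedHomogeneous w 0) :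
    quantization b (p * q) = quantization b p * quantization b q := by
  have := quantization_mul h hp hq
  rw [filt_eq_bot h.nonneg (by simp), Submodule.mem_bot, sub_eq_zero] at this
  exact this.symm

theorem commute_of_mem_filt_one (h : IsAdapted b w) {u v : U} (hu : u ∈ filt b w 1)
    (hv : v ∈ filt b w 1) : u * v = v * u := by
  obtain ⟨p, hp, rfl⟩ := exists_quantization_of_mem_filt_one h hu
  obtain ⟨q, hq, rfl⟩ := exists_quantization_of_mem_filt_one h hv
  rw [← quantization_mul_of_weight_zero h hp hq, mul_comm, quantization_mul_of_weight_zero h hq hp]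

theorem one_mem_filt_one : (1 : U) ∈ filt b w 1 := listProd_mem_filt (l := []) (by simp)

theorem filt_one_le {S : Submodule k U} (hw : ∀ i, 0 ≤ w i) (h1 : (1 : U) ∈ S)
    (hS : ∀ i, w i = 0 → ∀ u ∈ S, incl k (b i) * u ∈ S) : filt b w 1 ≤ S := by
  refine Submodule.span_le.2 ?_
  rintro _ ⟨l, hl', rfl⟩
  have hl : listWeight w l < 1 := hl'
  clear hl'
  induction l with
  | nil => exact h1
  | cons i l ih =>
    rw [listWeight_cons] at hl
    have h1 := hw i
    have h2 := listWeight_nonneg hw l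
    rw [listProd_cons]
    exact hS i (by lia) _ (ih (by lia))

end WeightZero

end UniversalEnvelopingAlgebra

end

noncomputable section

/-! ### Subfields of division rings -/

section DivisionRing

variable {D : Type*} [DivisionRing D]

theorem commute_of_mem_subfield_closure {s : Set D} {x : D} (h : ∀ y ∈ s, x * y = y * x) :
    ∀ y ∈ Subfield.closure s, x * y = y * x := by
  intro y hy
  induction hy using Subfield.closure_induction with
  | mem y hy => exact h y hy
  | one => simp
  | add y z _ _ hy hz => rw [mul_add, add_mul, hy, hz]
  | neg y _ hy => rw [mul_neg, neg_mul, hy]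
  | inv y _ hy => exact Commute.inv_right₀ (show Commute x y from hy)
  | mul y z _ _ hy hz => rw [← mul_assoc, hy, mul_assoc, hz, mul_assoc]

theorem subfield_closure_commutative {s : Set D} (h : ∀ x ∈ s, ∀ y ∈ s, x * y = y * x) :
    ∀ x ∈ Subfield.closure s, ∀ y ∈ Subfield.closure s, x * y = y * x := fun x hx =>
  commute_of_mem_subfield_closure fun y hy =>
    (commute_of_mem_subfield_closure (fun z hz => h y hy z hz) x hx).symm

/-- The elements of the division ring generated by a commutative subring are fractions. -/
theorem exists_fraction_of_mem_closure {S : Subring D} (hS : ∀ x ∈ S, ∀ y ∈ S, x * y = y * x)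
    {s : Set D} (hs : s ⊆ S) {x : D} (hx : x ∈ Subfield.closure s) :
    ∃ a ∈ S, a ≠ 0 ∧ a * x ∈ S := by
  induction hx using Subfield.closure_induction with
  | mem x hx => exact ⟨1, S.one_mem, one_ne_zero, by simpa using hs hx⟩
  | one => exact ⟨1, S.one_mem, one_ne_zero, by simp⟩
  | add x y _ _ hx hy =>
    obtain ⟨a, ha, ha0, hax⟩ := hx
    obtain ⟨c, hc, hc0, hcy⟩ := hy
    refine ⟨a * c, S.mul_mem ha hc, mul_ne_zero ha0 hc0, ?_⟩
    rw [mul_add, mul_assoc a c y, hS a ha c hc, mul_assoc c a x]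
    exact S.add_mem (S.mul_mem hc hax) (S.mul_mem ha hcy)
  | neg x _ hx =>
    obtain ⟨a, ha, ha0, hax⟩ := hx
    exact ⟨a, ha, ha0, by rw [mul_neg]; exact S.neg_mem hax⟩
  | inv x _ hx =>
    obtain ⟨a, ha, ha0, hax⟩ := hx
    by_cases hx0 : x = 0
    · exact ⟨1, S.one_mem, one_ne_zero, by simp [hx0, S.zero_mem]⟩
    · exact ⟨a * x, hax, mul_ne_zero ha0 hx0, by rwa [mul_inv_cancel_right₀ hx0]⟩
  | mul x y _ _ hx hy =>
    obtain ⟨a, ha, ha0, hax⟩ := hx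
    obtain ⟨c, hc, hc0, hcy⟩ := hy
    refine ⟨c * a, S.mul_mem hc ha, mul_ne_zero hc0 ha0, ?_⟩
    have : c * a * (x * y) = a * x * (c * y) := by
      rw [← mul_assoc, mul_assoc c a x, hS c hc _ hax, mul_assoc]
    rw [this]
    exact S.mul_mem hax hcy

end DivisionRing

namespace OreLocalization

variable {R : Type*} [Ring R] [OreSet R⁰]

theorem numeratorRingHom_injective :
    Function.Injective (numeratorRingHom : R →+* OreLocalization R⁰ R) :=
  numeratorHom_inj fun _ hx => (mem_nonZeroDivisors_iff.1 hx).1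

theorem exists_numerator_mul_eq [Nontrivial R] (z : OreLocalization R⁰ R) :
    ∃ s u : R, s ≠ 0 ∧ (numeratorRingHom s : OreLocalization R⁰ R) * z = numeratorRingHom u := by
  induction z using OreLocalization.ind with
  | _ r s =>
    refine ⟨s, r, nonZeroDivisors.ne_zero s.2, ?_⟩
    change ((s : R) /ₒ (1 : R⁰)) * (r /ₒ s) = r /ₒ 1
    exact OreLocalization.mul_cancel

end OreLocalization

namespace RegularSemidirect

open UniversalEnvelopingAlgebra MvPolynomial

variable {k A : Type*} [Field k] [Ring A] [Algebra k A]

/-! ### Conditions on the Lie algebra -/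

variable (k A) in
/-- The bijection with `A × A` as a linear equivalence. -/
def linearEquivProd : RegularSemidirect A ≃ₗ[k] A × A where
  toFun x := (x.g, x.v)
  map_add' _ _ := rfl
  map_smul' _ _ := rfl
  invFun p := ⟨p.1, p.2⟩
  left_inv _ := rfl
  right_inv _ := rfl

variable (k A) in
/-- The inclusion of `V` as a linear map. -/
def inV : A →ₗ[k] RegularSemidirect A where
  toFun v := ⟨0, v⟩
  map_add' _ _ := by ext <;> simp
  map_smul' _ _ := by ext <;> simp

@[simp] theorem inV_g (v : A) : (inV k A v).g = 0 := rfl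

@[simp] theorem inV_v (v : A) : (inV k A v).v = v := rfl

variable (k A) in
/-- The projection to `V` as a linear map. -/
def projV : RegularSemidirect A →ₗ[k] A where
  toFun x := x.v
  map_add' _ _ := rfl
  map_smul' _ _ := rfl

@[simp] theorem projV_apply (x : RegularSemidirect A) : projV k A x = x.v := rfl

variable (k A) in
/-- The existence of a linear form on `A` for which the bilinear form `f(xy)` is nondegenerate. -/
def HasNondegenerateForm : Prop :=
  ∃ f : Module.Dual k A, ∀ a : A, (∀ x, f (x * a) = 0) → a = 0

/-- The map `a ↦ f(· a)` of `A` to its dual. -/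
def toDualOfForm (f : Module.Dual k A) : A →ₗ[k] Module.Dual k A :=
  LinearMap.flip ((LinearMap.mul k A).compr₂ f)

@[simp] theorem toDualOfForm_apply (f : Module.Dual k A) (a x : A) :
    toDualOfForm f a x = f (x * a) := rfl

theorem finrank_V : Module.finrank k (V k A) = Module.finrank k A :=
  LinearEquiv.finrank_eq
    { toFun x := x.1.v
      map_add' _ _ := rfl
      map_smul' _ _ := rfl
      invFun v := ⟨inV k A v, rfl⟩
      left_inv x := Subtype.ext (RegularSemidirect.ext (Eq.symm x.2) rfl)
      right_inv _ := rfl }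

variable [FiniteDimensional k A]

/-- The identification of `A` with its dual given by a nondegenerate form. -/
def equivDualOfForm (f : Module.Dual k A) (hf : ∀ a : A, (∀ x, f (x * a) = 0) → a = 0) :
    A ≃ₗ[k] Module.Dual k A :=
  LinearEquiv.ofInjectiveOfFinrankEq (toDualOfForm f)
    ((injective_iff_map_eq_zero _).2 fun a ha => hf a fun x => LinearMap.congr_fun ha x)
    Subspace.dual_finrank_eq.symm

theorem equivDualOfForm_apply (f : Module.Dual k A) (hf : ∀ a : A, (∀ x, f (x * a) = 0) → a = 0)
    (a x : A) : equivDualOfForm f hf a x = f (x * a) := rfl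

theorem isFrobeniusAlgebra_iff : IsFrobeniusAlgebra k A ↔ HasNondegenerateForm k A := by
  constructor
  · rintro ⟨e, he⟩
    refine ⟨e 1, fun a ha => e.injective ?_⟩
    rw [map_zero]
    ext x
    rw [← mul_one a, he, ha]
    rfl
  · rintro ⟨f, hf⟩
    exact ⟨equivDualOfForm f hf, fun a c x => by simp [equivDualOfForm_apply, mul_assoc]⟩

/-- In finite dimension every functional is `f(· x)` for some `x`, so every functional kills `a`. -/
theorem eq_zero_of_form_left {f : Module.Dual k A} (hf : ∀ a : A, (∀ x, f (x * a) = 0) → a = 0)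
    {a : A} (ha : ∀ x, f (a * x) = 0) : a = 0 := by
  rw [← Module.forall_dual_apply_eq_zero_iff k]
  intro φ
  obtain ⟨x, rfl⟩ := (equivDualOfForm f hf).surjective φ
  exact ha x

instance : FiniteDimensional k (RegularSemidirect A) :=
  (linearEquivProd k A).symm.finiteDimensional

theorem exists_isRegularForm (k L : Type*) [Field k] [LieRing L] [LieAlgebra k L] :
    ∃ f : Module.Dual k L, IsRegularForm k f :=
  ciInf_mem fun f : Module.Dual k L => Module.finrank k (lieStabilizer k f)

/-- A form on `L` with zero stabilizer restricts to a nondegenerate one on `V`, since `V` brackets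
nontrivially only with `𝔤`. Conversely, extend `f` by zero on `𝔤`: testing a stabilizing element
against `V` kills its `𝔤`-component, and testing against `𝔤` then kills its `V`-component. -/
theorem isFrobeniusLieAlgebra_iff :
    IsFrobeniusLieAlgebra k (RegularSemidirect A) ↔ HasNondegenerateForm k A := by
  constructor
  · intro h
    obtain ⟨f, hf⟩ := exists_isRegularForm k (RegularSemidirect A)
    rw [IsRegularForm, show lieIndex k (RegularSemidirect A) = 0 from h,
      Submodule.finrank_eq_zero] at hf
    refine ⟨f ∘ₗ inV k A, fun a ha => ?_⟩
    have hmem : inV k A a ∈ lieStabilizer k f := fun y => by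
      have : ⁅inV k A a, y⁆ = inV k A (-(y.g * a)) := by
        ext <;> simp [-map_neg]
      rw [this, map_neg, map_neg, neg_eq_zero]
      exact ha y.g
    rw [hf, Submodule.mem_bot] at hmem
    exact congrArg RegularSemidirect.v hmem
  · rintro ⟨f, hf⟩
    refine Nat.eq_zero_of_le_zero ((ciInf_le (OrderBot.bddBelow _) (f ∘ₗ projV k A)).trans ?_)
    rw [Nat.le_zero, Submodule.finrank_eq_zero, Submodule.eq_bot_iff]
    intro x hx
    have hg : x.g = 0 := eq_zero_of_form_left hf fun v => by simpa using hx (inV k A v)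
    have hv : x.v = 0 := hf _ fun a => by simpa [hg] using hx ⟨a, 0⟩
    ext
    · exact hg
    · exact hv

theorem finrank_eq : Module.finrank k (RegularSemidirect A) = 2 * Module.finrank k A := by
  rw [(linearEquivProd k A).finrank_eq, Module.finrank_prod, two_mul]

theorem isCPIdeal_iff :
    IsCPIdeal (V k A) ↔ IsFrobeniusLieAlgebra k (RegularSemidirect A) := by
  have hcomm : ∀ x ∈ V k A, ∀ y ∈ V k A, ⁅x, y⁆ = 0 := by
    intro x (hx : x.g = 0) y (hy : y.g = 0)
    ext <;> simp [hx, hy]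
  constructor
  · rintro ⟨⟨_, h⟩, _⟩
    obtain ⟨f, hf⟩ := exists_isRegularForm k (RegularSemidirect A)
    have := (h f hf).2
    rw [hf, finrank_eq, finrank_V] at this
    exact Nat.add_eq_left.1 this.symm
  · intro h
    refine ⟨⟨hcomm, fun f hf => ⟨fun x hx y hy => by rw [hcomm x hx y hy, map_zero], ?_⟩⟩, ?_⟩
    · rw [hf, show lieIndex k (RegularSemidirect A) = 0 from h, finrank_eq, finrank_V, add_zero]
    · intro x y (hy : y.g = 0)
      change x.g * y.g - y.g * x.g = 0
      simp [hy]

end RegularSemidirect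

end

noncomputable section

namespace RegularSemidirect

open UniversalEnvelopingAlgebra MvPolynomial

/-! ### The enveloping algebra of the semi-direct product -/

variable {k A κ : Type*} [Field k] [Ring A] [Algebra k A]

/-- The matrices with rows `(g, v)` and `(0, 0)` form a faithful associative representation of `L`,
which factors through `U(L)`. -/
theorem incl_injective : Function.Injective
    (incl k : RegularSemidirect A → UniversalEnvelopingAlgebra k (RegularSemidirect A)) := by
  let _ : LieRing (Matrix (Fin 2) (Fin 2) A) := LieRing.ofAssociativeRing
  let f : RegularSemidirect A →ₗ⁅k⁆ Matrix (Fin 2) (Fin 2) A :=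
    { toFun x := !![x.g, x.v; 0, 0]
      map_add' x y := by simp
      map_smul' c x := by simp
      map_lie' {x y} := by
        rw [LieRing.of_associative_ring_bracket]
        simp }
  intro x y hxy
  have h : f x = f y := by
    rw [← lift_ι_apply k f x, ← lift_ι_apply k f y]
    exact congrArg (lift k f) hxy
  ext
  · exact congrFun (congrFun h 0) 0
  · exact congrFun (congrFun h 0) 1

/-- The basis of the semi-direct product given by a basis of `A`. -/
def basis (c : Module.Basis κ k A) : Module.Basis (κ ⊕ κ) k (RegularSemidirect A) :=
  (c.prod c).map (linearEquivProd k A).symm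

@[simp] theorem basis_inl (c : Module.Basis κ k A) (i : κ) : basis c (Sum.inl i) = ⟨c i, 0⟩ := by
  simp only [basis, Module.Basis.map_apply, Module.Basis.prod_apply]
  rfl

@[simp] theorem basis_inr (c : Module.Basis κ k A) (i : κ) :
    basis c (Sum.inr i) = inV k A (c i) := by
  simp only [basis, Module.Basis.map_apply, Module.Basis.prod_apply]
  rfl

/-- The weights for which `𝔤` has weight one and `V` has weight zero. -/
def weight : κ ⊕ κ → ℤ := Sum.elim 1 0

@[simp] theorem weight_inl (i : κ) : weight (Sum.inl i) = 1 := rfl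

@[simp] theorem weight_inr (i : κ) : weight (Sum.inr i) = 0 := rfl

theorem weight_nonneg (i : κ ⊕ κ) : 0 ≤ weight i := by
  cases i <;> simp

theorem inV_mem_span (c : Module.Basis κ k A) (v : A) :
    inV k A v ∈ Submodule.span k (basis c '' {l | weight l = 0}) := by
  induction c.mem_span v using Submodule.span_induction with
  | mem v hv =>
    obtain ⟨i, rfl⟩ := hv
    exact Submodule.subset_span ⟨Sum.inr i, rfl, basis_inr c i⟩
  | zero => rw [map_zero]; exact zero_mem _
  | add x y _ _ hx hy => rw [map_add]; exact add_mem hx hy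
  | smul a x _ hx => rw [map_smul]; exact Submodule.smul_mem _ a hx

theorem basis_inl_lie (c : Module.Basis κ k A) (i : κ) (v : A) :
    ⁅basis c (Sum.inl i), inV k A v⁆ = inV k A (c i * v) := by
  ext <;> simp

theorem lie_inV_mem_span (c : Module.Basis κ k A) (v : A) (i : κ ⊕ κ) :
    ⁅basis c i, inV k A v⁆ ∈ Submodule.span k (basis c '' {l | weight l = weight i - 1}) := by
  cases i with
  | inl i =>
    rw [basis_inl_lie]
    simpa using inV_mem_span c (c i * v)
  | inr i =>
    have : ⁅basis c (Sum.inr i), inV k A v⁆ = 0 := by ext <;> simp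
    rw [this]
    exact zero_mem _

theorem isAdapted_weight (c : Module.Basis κ k A) : IsAdapted (basis c) weight where
  nonneg := weight_nonneg
  lie_mem i j := by
    have hsub (i : κ ⊕ κ) (j : κ) : ⁅basis c i, basis c (Sum.inr j)⁆ ∈
        Submodule.span k (basis c '' {l | weight l + 1 ≤ weight i + weight (Sum.inr j)}) := by
      refine Submodule.span_mono (Set.image_mono fun l hl => ?_)
        (basis_inr c j ▸ lie_inV_mem_span c (c j) i)
      have hl : weight l = weight i - 1 := hl
      change weight l + 1 ≤ weight i + 0
      lia
    cases j with
    | inr j => exact hsub i j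
    | inl j =>
      cases i with
      | inr i =>
        rw [← lie_skew, add_comm (weight _)]
        exact neg_mem (hsub _ i)
      | inl i =>
        have : {l : κ ⊕ κ | weight l + 1 ≤ weight (Sum.inl i) + weight (Sum.inl j)} = Set.univ := by
          ext l
          cases l <;> simp
        rw [this, Set.image_univ, (basis c).span_eq]
        trivial

/-! ### The structure matrix -/

/-- The linear form on `A*` given by an element of `A`, as a polynomial. -/
def coordPolynomial (c : Module.Basis κ k A) : A →ₗ[k] MvPolynomial κ k := c.constr k X

@[simp] theorem coordPolynomial_basis (c : Module.Basis κ k A) (i : κ) :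
    coordPolynomial c (c i) = X i :=
  c.constr_basis k _ i

theorem eval_coordPolynomial (c : Module.Basis κ k A) (f : Module.Dual k A) (a : A) :
    eval (fun i => f (c i)) (coordPolynomial c a) = f a := by
  have : (aeval fun i => f (c i)).toLinearMap ∘ₗ coordPolynomial c = f :=
    c.ext fun i => by simp
  exact LinearMap.congr_fun this a

theorem linearForm_inV (c : Module.Basis κ k A) (v : A) :
    linearForm (basis c) (inV k A v) = rename Sum.inr (coordPolynomial c v) := by
  have : linearForm (basis c) ∘ₗ inV k A = (rename Sum.inr).toLinearMap ∘ₗ coordPolynomial c :=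
    c.ext fun i => by simp [← basis_inr]
  exact LinearMap.congr_fun this v

/-- The matrix of the products of basis elements, with entries in `S(V)`. -/
def structureMatrix (c : Module.Basis κ k A) : Matrix κ κ (MvPolynomial κ k) :=
  Matrix.of fun i j => coordPolynomial c (c i * c j)

local notation "U" => UniversalEnvelopingAlgebra k (RegularSemidirect A)

theorem rename_isWeightedHomogeneous (p : MvPolynomial κ k) :
    (rename (Sum.inr : κ → κ ⊕ κ) p).IsWeightedHomogeneous weight 0 := by
  induction p using MvPolynomial.induction_on with
  | C a => rw [rename_C]; exact isWeightedHomogeneous_C _ _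
  | add p q hp hq => rw [map_add]; exact hp.add hq
  | mul_X p i hp =>
    rw [map_mul, rename_X]
    exact hp.mul (isWeightedHomogeneous_X k weight (Sum.inr i))

theorem commute_filt_one (c : Module.Basis κ k A) {u : U}
    (hu : ∀ j, u * incl k (inV k A (c j)) = incl k (inV k A (c j)) * u) :
    ∀ v ∈ filt (basis c) weight 1, u * v = v * u := by
  intro v hv
  refine filt_one_le (S := (Subalgebra.centralizer k {u}).toSubmodule) weight_nonneg ?_ ?_ hv u rfl
  · exact one_mem (Subalgebra.centralizer k {u})
  · rintro (i | i) hi v hv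
    · simp at hi
    · refine mul_mem (S := Subalgebra k U) (s := Subalgebra.centralizer k {u}) ?_ hv
      rintro _ rfl
      rw [basis_inr, hu]

variable [Fintype κ]

/-- Evaluating the matrix at a form `f` yields the Gram matrix of `f(xy)`, and a polynomial over an
infinite field is nonzero exactly when some value is. -/
theorem det_structureMatrix_ne_zero_iff [DecidableEq κ] [CharZero k] (c : Module.Basis κ k A) :
    (structureMatrix c).det ≠ 0 ↔ HasNondegenerateForm k A := by
  have heval (f : Module.Dual k A) : eval (fun i => f (c i)) (structureMatrix c).det ≠ 0 ↔
      ∀ a : A, (∀ x, f (x * a) = 0) → a = 0 := by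
    rw [RingHom.map_det, ← not_iff_not, not_not, ← Matrix.exists_mulVec_eq_zero_iff]
    have hmul (v : κ → k) (i : κ) : ((eval fun i => f (c i)).mapMatrix (structureMatrix c)).mulVec v i
        = f (c i * c.equivFun.symm v) := by
      simp [Matrix.mulVec, dotProduct, structureMatrix, eval_coordPolynomial,
        Module.Basis.equivFun_symm_apply, Finset.mul_sum, mul_comm]
    push Not
    constructor
    · rintro ⟨v, hv, h⟩
      refine ⟨c.equivFun.symm v, fun x => ?_, c.equivFun.symm.map_ne_zero_iff.2 hv⟩
      have : f ∘ₗ LinearMap.mulRight k (c.equivFun.symm v) = 0 :=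
        c.ext fun i => by
          have := hmul v i
          rw [h] at this
          exact this.symm
      exact LinearMap.congr_fun this x
    · rintro ⟨a, ha, ha0⟩
      refine ⟨c.equivFun a, by simpa using ha0, ?_⟩
      ext i
      rw [hmul, LinearEquiv.symm_apply_apply, ha]
      rfl
  constructor
  · intro h
    by_contra hno
    refine h (MvPolynomial.funext fun x => ?_)
    rw [map_zero]
    by_contra hx
    refine hno ⟨c.constr k x, (heval _).1 ?_⟩
    simpa using hx
  · rintro ⟨f, hf⟩ h0
    exact (heval f).2 hf (by rw [h0, map_zero])

/-! ### The centralizer of `V` -/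

theorem bracketDerivation_inV (c : Module.Basis κ k A) (j : κ) (p : MvPolynomial (κ ⊕ κ) k) :
    bracketDerivation (basis c) (inV k A (c j)) p =
      ∑ i, pderiv (Sum.inl i) p * rename Sum.inr (structureMatrix c i j) := by
  classical
  let D : Derivation k (MvPolynomial (κ ⊕ κ) k) (MvPolynomial (κ ⊕ κ) k) :=
    ∑ i, (rename Sum.inr (structureMatrix c i j) : MvPolynomial (κ ⊕ κ) k) •
      (pderiv (Sum.inl i) : Derivation k (MvPolynomial (κ ⊕ κ) k) _)
  have hD (p : MvPolynomial (κ ⊕ κ) k) :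
      D p = ∑ i, pderiv (Sum.inl i) p * rename Sum.inr (structureMatrix c i j) := by
    change Derivation.coeFnAddMonoidHom D p = _
    rw [map_sum, Finset.sum_apply]
    exact Finset.sum_congr rfl fun i _ => mul_comm _ _
  rw [← hD]
  congr 1
  refine derivation_ext fun i => ?_
  rw [bracketDerivation_X, hD]
  cases i with
  | inl i =>
    rw [basis_inl_lie, linearForm_inV]
    simp [pderiv_X, Pi.single_apply, structureMatrix]
  | inr i =>
    have : ⁅basis c (Sum.inr i), inV k A (c j)⁆ = 0 := by ext <;> simp
    rw [this, map_zero]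
    simp [pderiv_X]

/-- If the symbol had positive weight, its `𝔤`-derivatives would form a left null vector of the
structure matrix. They vanish since the determinant is nonzero, and so does the symbol. -/
theorem mem_filt_of_commute [DecidableEq κ] [CharZero k] (c : Module.Basis κ k A)
    (hdet : (structureMatrix c).det ≠ 0) {u : U}
    (hu : ∀ j, u * incl k (inV k A (c j)) = incl k (inV k A (c j)) * u) :
    u ∈ filt (basis c) weight 1 := by
  by_cases hu0 : u = 0
  · rw [hu0]; exact zero_mem _
  obtain ⟨d, hud, p, hp, hp0, hup⟩ := exists_nonzero_symbol (isAdapted_weight c) hu0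
  rcases Nat.eq_zero_or_pos d with rfl | hd
  · simpa using hud
  refine absurd (eq_zero_of_pderiv_eq_zero hp (by positivity) fun i hi => ?_) hp0
  cases i with
  | inr i => simp at hi
  | inl i =>
    have hvec : Matrix.vecMul (fun i => pderiv (Sum.inl i) p)
        ((rename (Sum.inr : κ → κ ⊕ κ)).mapMatrix (structureMatrix c)) = 0 := by
      ext1 j
      have := bracketDerivation_eq_zero (lie_inV_mem_span c (c j)) incl_injective
        (isAdapted_weight c) hp hup (hu j)
      rw [bracketDerivation_inV] at this
      exact this
    by_contra hne
    refine (?_ : (rename (Sum.inr : κ → κ ⊕ κ)) (structureMatrix c).det ≠ 0) ?_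
    · rw [Ne, map_eq_zero_iff _ (rename_injective _ Sum.inr_injective)]
      exact hdet
    · rw [AlgHom.map_det, ← Matrix.exists_vecMul_eq_zero_iff]
      exact ⟨_, fun h => hne (congrFun h i), hvec⟩

/-- If the structure matrix is singular then the centralizer of `V` is not contained in `R(V)`. -/
theorem exists_commute_of_det_eq_zero [DecidableEq κ] [CharZero k] (c : Module.Basis κ k A)
    (hdet : (structureMatrix c).det = 0) :
    ∃ x : U, (∀ j, x * incl k (inV k A (c j)) = incl k (inV k A (c j)) * x) ∧
      ∀ s ∈ filt (basis c) weight 1, s ≠ 0 → s * x ∉ filt (basis c) weight 1 := by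
  have h := isAdapted_weight c
  obtain ⟨s, hs0, hs⟩ := Matrix.exists_vecMul_eq_zero_iff.2 hdet
  let r (i : κ) : MvPolynomial (κ ⊕ κ) k := rename Sum.inr (s i)
  have hr (i : κ) : (r i).IsWeightedHomogeneous weight 0 := rename_isWeightedHomogeneous (s i)
  have hmem {p : MvPolynomial (κ ⊕ κ) k} (hp : p.IsWeightedHomogeneous weight 0) :
      quantization (basis c) p ∈ filt (basis c) weight 1 :=
    quantization_mem_filt zero_lt_one hp
  have hV (j : κ) : incl k (inV k A (c j)) ∈ filt (basis c) weight 1 :=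
    incl_mem_filt_of_mem_span (Submodule.subset_span ⟨Sum.inr j, by simp, basis_inr c j⟩)
  -- The null vector `s` supplies the coefficients: the commutator with `c j` is the `j`-th entry of
  -- `s` times the matrix. The symbol `P` of this element has weight one and is nonzero, and
  -- multiplying by a nonzero `q` of weight zero keeps it so.
  refine ⟨∑ i, quantization (basis c) (r i) * incl k (basis c (Sum.inl i)), fun j => ?_,
    fun t ht ht0 htx => ?_⟩
  · rw [← sub_eq_zero, Finset.sum_mul, Finset.mul_sum, ← Finset.sum_sub_distrib]
    have hterm (i : κ) :
        quantization (basis c) (r i) * incl k (basis c (Sum.inl i)) * incl k (inV k A (c j)) -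
          incl k (inV k A (c j)) * (quantization (basis c) (r i) * incl k (basis c (Sum.inl i))) =
        quantization (basis c) (rename Sum.inr (s i * structureMatrix c i j)) := by
      rw [map_mul, quantization_mul_of_weight_zero h (hr i) (rename_isWeightedHomogeneous _),
        show structureMatrix c i j = coordPolynomial c (c i * c j) from rfl, ← linearForm_inV,
        quantization_linearForm, ← basis_inl_lie, incl_bracket, mul_sub, ← mul_assoc, ← mul_assoc,
        ← mul_assoc, commute_of_mem_filt_one h (hV j) (hmem (hr i))]
    rw [Finset.sum_congr rfl fun i _ => hterm i, ← map_sum, ← map_sum]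
    have : ∑ i, s i * structureMatrix c i j = 0 := congrFun hs j
    rw [this, map_zero, map_zero]
  · obtain ⟨q, hq, rfl⟩ := exists_quantization_of_mem_filt_one h ht
    let P : MvPolynomial (κ ⊕ κ) k := ∑ i, r i * X (Sum.inl i)
    have hP : P.IsWeightedHomogeneous weight 1 := by
      refine IsWeightedHomogeneous.sum _ _ _ fun i _ => ?_
      simpa using (hr i).mul (isWeightedHomogeneous_X k weight (Sum.inl i))
    have hxP : ∑ i, quantization (basis c) (r i) * incl k (basis c (Sum.inl i)) -
        quantization (basis c) P ∈ filt (basis c) weight 1 := by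
      rw [map_sum, ← Finset.sum_sub_distrib]
      refine sum_mem fun i _ => ?_
      have := quantization_mul h (hr i) (isWeightedHomogeneous_X k weight (Sum.inl i))
      simpa using this
    have hqP : quantization (basis c) (q * P) ∈ filt (basis c) weight 1 := by
      have h₁ := quantization_mul h hq hP
      have h₂ := mul_mem_filt ht hxP (t := 1) (by norm_num)
      rw [zero_add] at h₁
      have := sub_mem htx (add_mem h₂ h₁)
      convert! this using 1
      noncomm_ring
    have hzero := eq_zero_of_quantization_mem_filt incl_injective h (by simpa using hq.mul hP) hqP
    have hq0 : q ≠ 0 := fun h0 => ht0 (by rw [h0, map_zero])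
    have hP0 := (mul_eq_zero.1 hzero).resolve_left hq0
    refine hs0 (_root_.funext fun i => ?_)
    -- Setting the `i`-th `𝔤`-variable to one and the others to zero extracts `s i` from `P`.
    have := congrArg (aeval (Sum.elim (fun j => if j = i then 1 else 0) X) :
      MvPolynomial (κ ⊕ κ) k →ₐ[k] MvPolynomial κ k) hP0
    simpa [P, r, bind₁_rename, Sum.elim_comp_inr, bind₁_X_left] using this

end RegularSemidirect

end

noncomputable section

namespace RegularSemidirect

open UniversalEnvelopingAlgebra

/-! ### Maximality of `R(V)` -/

variable {k A κ : Type*} [Field k] [Ring A] [Algebra k A]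

local notation "U" => UniversalEnvelopingAlgebra k (RegularSemidirect A)

theorem incl_mem_filt_of_mem_V (c : Module.Basis κ k A) {y : RegularSemidirect A}
    (hy : y ∈ V k A) : incl k y ∈ filt (basis c) weight 1 := by
  refine incl_mem_filt_of_mem_span ?_
  have h : y = inV k A y.v := RegularSemidirect.ext hy rfl
  have hset : {l : κ ⊕ κ | weight l + 1 ≤ 1} = {l | weight l = 0} := by
    ext l
    cases l <;> simp
  rw [h, hset]
  exact inV_mem_span c y.v

/-- The subring `U(V)` of `U(L)`. -/
def weightZeroSubring (c : Module.Basis κ k A) : Subring U where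
  carrier := filt (basis c) weight 1
  mul_mem' hu hv := mul_mem_filt hu hv le_rfl
  one_mem' := one_mem_filt_one
  add_mem' := add_mem
  zero_mem' := zero_mem _
  neg_mem' := neg_mem

theorem generators_subset (c : Module.Basis κ k A) :
    Set.range (algebraMap k U) ∪ UniversalEnvelopingAlgebra.ι k '' (V k A : Set _) ⊆
      weightZeroSubring c := by
  rintro _ (⟨a, rfl⟩ | ⟨y, hy, rfl⟩)
  · rw [Algebra.algebraMap_eq_smul_one]
    exact Submodule.smul_mem (filt (basis c) weight 1) a one_mem_filt_one
  · exact incl_mem_filt_of_mem_V c hy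

variable [IsDomain (UniversalEnvelopingAlgebra k (RegularSemidirect A))]
  [OreLocalization.OreSet (UniversalEnvelopingAlgebra k (RegularSemidirect A))⁰]

local notation "ν" =>
  (OreLocalization.numeratorRingHom : U →+* QuotientDivisionRing k (RegularSemidirect A))

theorem numerator_incl_mem (v : A) :
    ν (incl k (inV k A v)) ∈ subQuotientDivisionRing (V k A) :=
  Subfield.subset_closure ⟨_, Or.inr ⟨inV k A v, rfl, rfl⟩, rfl⟩

theorem numerator_mem_subQuotientDivisionRing (c : Module.Basis κ k A) {u : U}
    (hu : u ∈ filt (basis c) weight 1) : ν u ∈ subQuotientDivisionRing (V k A) := by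
  let S : Submodule k U :=
    { carrier := {u | ν u ∈ subQuotientDivisionRing (V k A)}
      add_mem' := fun {u v} hu hv => by
        change ν (u + v) ∈ subQuotientDivisionRing (V k A)
        rw [map_add]; exact add_mem hu hv
      zero_mem' := by
        change ν 0 ∈ subQuotientDivisionRing (V k A)
        rw [map_zero]; exact zero_mem _
      smul_mem' := fun a u hu => by
        change ν (a • u) ∈ subQuotientDivisionRing (V k A)
        rw [Algebra.smul_def, map_mul]
        exact mul_mem (Subfield.subset_closure ⟨_, Or.inl ⟨a, rfl⟩, rfl⟩) hu }
  refine filt_one_le (S := S) weight_nonneg ?_ ?_ hu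
  · change ν 1 ∈ subQuotientDivisionRing (V k A)
    rw [map_one]; exact one_mem _
  · rintro (i | i) hi u hu
    · simp at hi
    · change ν (_ * u) ∈ subQuotientDivisionRing (V k A)
      rw [map_mul, basis_inr]
      exact mul_mem (numerator_incl_mem (c i)) hu

theorem subQuotientDivisionRing_commutative (c : Module.Basis κ k A) :
    ∀ x ∈ subQuotientDivisionRing (V k A), ∀ y ∈ subQuotientDivisionRing (V k A),
      x * y = y * x := by
  refine subfield_closure_commutative ?_
  rintro _ ⟨u, hu, rfl⟩ _ ⟨v, hv, rfl⟩
  simp only [← map_mul]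
  rw [commute_of_mem_filt_one (isAdapted_weight c) (generators_subset c hu)
    (generators_subset c hv)]

/-- If the structure matrix is regular then `R(V)` is its own centralizer. -/
theorem mem_subQuotientDivisionRing_of_commute [Fintype κ] [DecidableEq κ] [CharZero k]
    (c : Module.Basis κ k A) (hdet : (structureMatrix c).det ≠ 0)
    {z : QuotientDivisionRing k (RegularSemidirect A)}
    (hz : ∀ j, z * ν (incl k (inV k A (c j))) = ν (incl k (inV k A (c j))) * z) :
    z ∈ subQuotientDivisionRing (V k A) := by
  classical
  have h := isAdapted_weight c
  have hinj : Function.Injective ν := OreLocalization.numeratorRingHom_injective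
  -- Take a denominator `s` of `z` in the lowest possible step. As `z` commutes with `v` in `V`, the
  -- commutator `[s, v]` is again a denominator, with numerator `[u, v]`. It lies one step lower, so
  -- it must be zero.
  have hex : ∃ n : ℕ, ∃ s ∈ filt (basis c) weight (n : ℤ), s ≠ 0 ∧ ∃ u : U, ν s * z = ν u := by
    obtain ⟨s, u, hs, hsu⟩ := OreLocalization.exists_numerator_mul_eq z
    obtain ⟨n, hn⟩ := exists_mem_filt (basis c) weight s
    exact ⟨n, s, hn, hs, u, hsu⟩
  obtain ⟨s, hs, hs0, u, hsu⟩ := Nat.find_spec hex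
  have hn : Nat.find hex ≠ 0 := fun h0 => hs0 (by
    rwa [h0, Nat.cast_zero, filt_eq_bot h.nonneg le_rfl, Submodule.mem_bot] at hs)
  have hscomm (j : κ) : s * incl k (inV k A (c j)) = incl k (inV k A (c j)) * s := by
    rw [← sub_eq_zero]
    by_contra hne
    refine Nat.find_min hex (m := Nat.find hex - 1) (by lia) ⟨_, ?_, hne,
      u * incl k (inV k A (c j)) - incl k (inV k A (c j)) * u, ?_⟩
    · rw [Nat.cast_sub (Nat.one_le_iff_ne_zero.2 hn), Nat.cast_one]
      exact bracket_mem_filt (lie_inV_mem_span c (c j)) h hs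
    · simp only [map_sub, map_mul, ← hsu]
      rw [sub_mul, mul_assoc, ← hz, mul_assoc, mul_assoc]
  have hucomm (j : κ) : u * incl k (inV k A (c j)) = incl k (inV k A (c j)) * u := by
    apply hinj
    rw [map_mul, map_mul, ← hsu, mul_assoc, hz, ← mul_assoc, ← mul_assoc, ← map_mul, ← map_mul,
      hscomm]
  have hs1 := numerator_mem_subQuotientDivisionRing c (mem_filt_of_commute c hdet hscomm)
  have hu1 := numerator_mem_subQuotientDivisionRing c (mem_filt_of_commute c hdet hucomm)
  have hνs : ν s ≠ 0 := by rwa [Ne, map_eq_zero_iff _ hinj]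
  have : z = (ν s)⁻¹ * ν u := by rw [← hsu, inv_mul_cancel_left₀ hνs]
  rw [this]
  exact mul_mem (inv_mem hs1) hu1

/-- The commutative field `R(V)` is maximal exactly when it is its own centralizer: adjoining a
commuting element gives a larger commutative field unless that element already lies in `R(V)`. -/
theorem isMaximalSubfield_iff [FiniteDimensional k A] [CharZero k] :
    IsMaximalSubfield (subQuotientDivisionRing (V k A)) ↔ HasNondegenerateForm k A := by
  let c := Module.finBasis k A
  have h := isAdapted_weight c
  have hinj : Function.Injective ν := OreLocalization.numeratorRingHom_injective
  rw [← det_structureMatrix_ne_zero_iff c]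
  constructor
  · intro hmax hdet
    obtain ⟨x, hx, hxS⟩ := exists_commute_of_det_eq_zero c hdet
    have hcomm := commute_filt_one c hx
    let gens : Set (QuotientDivisionRing k (RegularSemidirect A)) :=
      ν '' (Set.range (algebraMap k U) ∪ UniversalEnvelopingAlgebra.ι k '' (V k A : Set _))
    have hF : ∀ y ∈ Subfield.closure (insert (ν x) gens),
        ∀ z ∈ Subfield.closure (insert (ν x) gens), y * z = z * y := by
      refine subfield_closure_commutative ?_
      rintro _ (rfl | ⟨u, hu, rfl⟩) _ (rfl | ⟨v, hv, rfl⟩)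
      · rfl
      · rw [← map_mul, ← map_mul, hcomm v (generators_subset c hv)]
      · rw [← map_mul, ← map_mul, hcomm u (generators_subset c hu)]
      · rw [← map_mul, ← map_mul, commute_of_mem_filt_one h (generators_subset c hu)
          (generators_subset c hv)]
    have hle : subQuotientDivisionRing (V k A) ≤ Subfield.closure (insert (ν x) gens) :=
      Subfield.closure_mono (Set.subset_insert _ _)
    have hmem : ν x ∈ subQuotientDivisionRing (V k A) :=
      hmax.2 hF hle (Subfield.subset_closure (Set.mem_insert _ _))
    -- An element of `R(V)` is a fraction over `U(V)`, so some nonzero `s` in `U(V)` would satisfy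
    -- `s * x ∈ U(V)`, which `hxS` excludes.
    obtain ⟨_, ⟨s, hs, rfl⟩, hs0, t, ht, hst⟩ :=
      exists_fraction_of_mem_closure (S := (weightZeroSubring c).map ν) (by
        rintro _ ⟨u, hu, rfl⟩ _ ⟨v, hv, rfl⟩
        rw [← map_mul, ← map_mul, commute_of_mem_filt_one h hu hv])
        (Set.image_mono (generators_subset c)) hmem
    rw [← map_mul] at hst
    refine hxS s hs (fun h0 => hs0 (by rw [h0, map_zero])) ?_
    rw [← hinj hst]
    exact ht
  · intro hdet
    refine ⟨subQuotientDivisionRing_commutative c, fun F hF hle z hz => ?_⟩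
    exact mem_subQuotientDivisionRing_of_commute c hdet fun j =>
      hF z hz _ (hle (numerator_incl_mem (c j)))

end RegularSemidirect

end

/-- The two existential binders say that `U(L)` is an Ore domain, so that `D(L)` exists. -/
theorem proposition5p6 {k : Type*} [Field k] [CharZero k] {A : Type*} [Ring A] [Algebra k A]
    [FiniteDimensional k A] :
    ∃ (_ : IsDomain (UniversalEnvelopingAlgebra k (RegularSemidirect A)))
      (_ : OreLocalization.OreSet (UniversalEnvelopingAlgebra k (RegularSemidirect A))⁰),
      List.TFAE [
        IsFrobeniusAlgebra k A,
        IsFrobeniusLieAlgebra k (RegularSemidirect A),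
        IsCPIdeal (RegularSemidirect.V k A),
        IsMaximalSubfield (subQuotientDivisionRing (RegularSemidirect.V k A))] := by
  have hdom : IsDomain (UniversalEnvelopingAlgebra k (RegularSemidirect A)) :=
    UniversalEnvelopingAlgebra.isDomain_of_incl_injective RegularSemidirect.incl_injective
  obtain ⟨hore⟩ := UniversalEnvelopingAlgebra.nonempty_oreSet (k := k) (L := RegularSemidirect A)
  refine ⟨hdom, hore, ?_⟩
  rw [RegularSemidirect.isCPIdeal_iff, RegularSemidirect.isMaximalSubfield_iff,
    RegularSemidirect.isFrobeniusLieAlgebra_iff, RegularSemidirect.isFrobeniusAlgebra_iff]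
  tfae_finish
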